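/- Let $A$ be a Noetherian unique factorization domain with fraction field $K$. Let $q\ge 1$ and $n_1,\dots,n_q\ge 1$, and let $A[\mathbf x]$ be the polynomial ring in the variables $x_{p,i}$ ($1\le p\le q$, $0\le i\le n_p$), $\mathbb N^q$-graded so that constants have multidegree $0$ and $x_{p,i}$ has multidegree $\mathbf e_p$, the $p$-th unit vector. Order $\mathbb N^q$ componentwise; a property holds "for $\nu$ large enough" if there is $\nu_0\in\mathbb N^q$ such that it holds for all $\nu\ge\nu_0$. Let $M=\bigoplus_{\nu\in\mathbb N^q}M_\nu$ be a componentwise free $A[\mathbf x]$-module, i.e. a finitely generated $\mathbb N^q$-graded $A[\mathbf x]$-module whose components $M_\nu$ are free $A$-modules of finite rank. Let $H_M\in\mathbb Q[t_1,\dots,t_q]$ be its Hilbert polynomial, so that $H_M(\nu)=\dim_K(M_\nu\otimes_A K)$ for $\nu$ large enough, and let $r$ be the relevant dimension of $M$: $r=-1$ if $H_M=0$, and $r=\deg H_M$ (total degree) otherwise. Let $\mathbf f=(f_0,\dots,f_r)$ be a filter-regular sequence for $M$: each $f_i\in A[\mathbf x]$ is multihomogeneous, of some multidegree $d^{(i)}$,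 and for each $i$, for $\nu$ large enough, no nonzero element of the component of multidegree $\nu$ of $M/(f_0,\dots,f_{i-1})M$ is annihilated by $f_i$. Let $K_\bullet(\mathbf f,M)$ be the Koszul complex, $K_p(\mathbf f,M)=\bigwedge^p\big(\bigoplus_{i=0}^{r}A[\mathbf x]e_i\big)\otimes M$, graded by $\deg(e_{i_1}\wedge\dots\wedge e_{i_p}\otimes m)=d^{(i_1)}+\dots+d^{(i_p)}+\deg m$, and let $K^\nu_\bullet(\mathbf f,M)$ be its component of multidegree $\nu$, a complex of free $A$-modules of finite rank in homological degrees $0,\dots,r+1$. Then for $\nu$ large enough: 1. $K^\nu_\bullet(\mathbf f,M)$ is generically exact, i.e. $K^\nu_\bullet(\mathbf f,M)\otimes_AK$ is exact; in particular $(M/(\mathbf f)M)_\nu$ is a torsion $A$-module; 2. the Cayley determinant of $K^\nu_\bullet(\mathbf f,M)$ is defined and $$\det\nolimits_A\big(K^\nu_\bullet(\mathbf f,M)\big)=\chi_A\big((M/(\mathbf f)M)_\nu\big)\pmod{A^\times}.$$ Here the content of a finitely generated torsion $A$-module $N$ is $\chi_A(N)=\prod_{\pi}\pi^{\ell(N_{(\pi)})}$,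 where $\pi$ runs over a system of representatives, up to units, of the irreducible elements of $A$, and $\ell(N_{(\pi)})$ is the length of the localization $N_{(\pi)}$ over $A_{(\pi)}$. The Cayley determinant of a generically exact complex $0\to C_s\xrightarrow{\partial_s}\cdots\xrightarrow{\partial_1} C_0\to0$ of free $A$-modules of finite rank is $\prod_{i=1}^{s}\det(\varphi_i)^{(-1)^{i+1}}\in K^\times$, for any choice of bases $u_i$ of the $C_i$ and of partitions $u_i=u_i'\sqcup u_i''$ with $u_0''=u_s'=\emptyset$ such that the block $\varphi_i$ of the matrix of $\partial_i$ with columns in $u_i''$ and rows in $u_{i-1}'$ is square with nonzero determinant; statement 2 says that such choices exist and that, for each of them, this element of $K$ equals $\chi_A((M/(\mathbf f)M)_\nu)$ times a unit of $A$. -/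

import Mathlib

namespace MultiKoszul

/-! ### Multigraded polynomial rings and modules -/

/-- The index set of the variables `x_{p,i}`, for `p` in a set of `q` groups and `0 ≤ i ≤ n p`. -/
abbrev Vars {q : ℕ} (n : Fin q → ℕ) : Type := (p : Fin q) × Fin (n p + 1)

/-- The multigraded polynomial ring `A[x]`, as a plain ring. -/
abbrev Poly (A : Type*) [CommRing A] {q : ℕ} (n : Fin q → ℕ) : Type _ := MvPolynomial (Vars n) A

/-- The component of `A[x]` of multidegree `d`, where `x_{p,i}` has multidegree `e_p`. -/
def polyGrading (A : Type*) [CommRing A] {q : ℕ} (n : Fin q → ℕ) (d : Fin q → ℕ) :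
    Submodule A (Poly A n) :=
  MvPolynomial.weightedHomogeneousSubmodule A
    (fun v : Vars n => (Pi.single v.1 1 : Fin q → ℕ)) d

section Modules

variable {A : Type*} [CommRing A] {q : ℕ} {R : Type*} [CommRing R] [Algebra A R]
  {M : Type*} [AddCommGroup M] [Module A M] [Module R M] [IsScalarTower A R M]

/-- The components `(M/N)_ν = M_ν / (N ∩ M_ν)` of a quotient, realised as the images of the
components of `M`. -/
def quotGrading (ℳ : (Fin q → ℕ) → Submodule A M) (N : Submodule R M) (ν : Fin q → ℕ) :
    Submodule A (M ⧸ N) :=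
  (ℳ ν).map (N.mkQ.restrictScalars A)

/-- The colon submodule `(0 :_M f)` is zero in all large multidegrees. -/
def IsFilterRegular (ℳ : (Fin q → ℕ) → Submodule A M) (f : R) : Prop :=
  ∀ᶠ ν in Filter.atTop, ∀ m ∈ ℳ ν, f • m = 0 → m = 0

/-- `f i` is filter-regular for `M / (f 0, …, f (i-1)) M`, for every `i`. (That the `f i` are
multihomogeneous is stated separately.) -/
def IsFilterRegularSeq (ℳ : (Fin q → ℕ) → Submodule A M) {s : ℕ} (f : Fin s → R) : Prop :=
  ∀ i : Fin s,
    IsFilterRegular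
      (quotGrading ℳ (Ideal.span (f '' {j | j < i}) • (⊤ : Submodule R M))) (f i)

/-- The multihomogeneous components of `M / (f) M`. -/
def koszulQuot (ℳ : (Fin q → ℕ) → Submodule A M) {s : ℕ} (f : Fin s → R) (ν : Fin q → ℕ) :
    Submodule A (M ⧸ (Ideal.span (Set.range f) • (⊤ : Submodule R M))) :=
  quotGrading ℳ (Ideal.span (Set.range f) • (⊤ : Submodule R M)) ν

end Modules

/-- A finitely generated `A[x]`-module, with the given multigrading, whose components are free
`A`-modules of finite rank. -/
structure IsComponentwiseFree {A : Type*} [CommRing A] {q : ℕ} (n : Fin q → ℕ)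
    {M : Type*} [AddCommGroup M] [Module A M] [Module (Poly A n) M]
    (ℳ : (Fin q → ℕ) → Submodule A M) : Prop where
  finite : Module.Finite (Poly A n) M
  free_component : ∀ ν, Module.Free A (ℳ ν)
  finite_component : ∀ ν, Module.Finite A (ℳ ν)

/-! ### Hilbert polynomial and relevant dimension -/

section Hilbert

variable {A : Type*} [CommRing A] {q : ℕ} {M : Type*} [AddCommGroup M] [Module A M]

/-- `P` agrees with the generic rank `dim_K (K ⊗ M_ν)`, `K = Frac A`, for all large `ν`. -/
def IsHilbertPoly (ℳ : (Fin q → ℕ) → Submodule A M) (P : MvPolynomial (Fin q) ℚ) : Prop :=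
  ∀ᶠ ν : Fin q → ℕ in Filter.atTop,
    (Module.finrank (FractionRing A) (TensorProduct A (FractionRing A) (ℳ ν)) : ℚ) =
      MvPolynomial.eval (fun p => (ν p : ℚ)) P

/-- The Hilbert polynomial is unique. -/
theorem IsHilbertPoly.unique {ℳ : (Fin q → ℕ) → Submodule A M} {P Q : MvPolynomial (Fin q) ℚ}
    (hP : IsHilbertPoly ℳ P) (hQ : IsHilbertPoly ℳ Q) : P = Q := by
  obtain ⟨ν₀, h⟩ := Filter.eventually_atTop.1 (hP.and hQ)
  refine MvPolynomial.funext_set (fun p => (fun k : ℕ => (k : ℚ)) '' Set.Ici (ν₀ p))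
    (fun p => ((Set.Ici_infinite (ν₀ p)).image
      (Nat.cast_injective (R := ℚ)).injOn)) (fun x hx => ?_)
  have hx' : ∀ p, ∃ k : ℕ, ν₀ p ≤ k ∧ (k : ℚ) = x p := fun p => by
    simpa using hx p (Set.mem_univ p)
  choose ν hν hxν using hx'
  have := h ν hν
  obtain rfl : (fun p => (ν p : ℚ)) = x := funext hxν
  rw [← this.1, ← this.2]

open Classical in
/-- The relevant dimension is `r`: it is `-1` if the Hilbert polynomial is zero, and the total
degree of the Hilbert polynomial otherwise. -/
def HasRelevantDim (ℳ : (Fin q → ℕ) → Submodule A M) (r : ℤ) : Prop :=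
  ∃ P : MvPolynomial (Fin q) ℚ, IsHilbertPoly ℳ P ∧
    r = if P = 0 then -1 else (P.totalDegree : ℤ)

end Hilbert

/-! ### The Koszul complex and its slices

The summand of `(⋀^p L) ⊗ M` spanned by `e_I ⊗ M`, for `I` a `p`-element subset of the index set,
is recorded as the coordinate `I` of a function. -/

section Koszul

/-- The `p`-element subsets of `{0, …, s - 1}`, indexing the standard basis of `⋀^p L`. -/
abbrev Sub (s p : ℕ) : Type := {I : Finset (Fin s) // I.card = p}

/-- `J ∪ {i}`, for `i ∉ J`. -/
def Sub.insert {s p : ℕ} (J : Sub s p) (i : {i : Fin s // i ∉ J.1}) : Sub s (p + 1) :=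
  ⟨Insert.insert i.1 J.1, by rw [Finset.card_insert_of_notMem i.2, J.2]⟩

/-- `(-1)^k`, where `k` is the number of elements of `J` before `i`. -/
def koszulSign (R : Type*) [CommRing R] {s : ℕ} (J : Finset (Fin s)) (i : Fin s) : R :=
  (-1) ^ (J.filter (· < i)).card

/-- `K_p(f, M) = (⋀^p L) ⊗ M`. -/
abbrev KoszulModule (s : ℕ) (M : Type*) (p : ℕ) : Type _ := Sub s p → M

variable {R : Type*} [CommRing R] {M : Type*} [AddCommGroup M] [Module R M] {s : ℕ}

/-- The Koszul differential `∂_{p+1} : K_{p+1} → K_p`, read on coordinates: it maps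
`e_{i_1} ∧ … ∧ e_{i_{p+1}} ⊗ m`, with `i_1 < … < i_{p+1}`, to the sum over `t` of
`(-1)^{t+1} f_{i_t} e_{i_1} ∧ … (without e_{i_t}) … ∧ e_{i_{p+1}} ⊗ m`. -/
def koszulD (f : Fin s → R) (M : Type*) [AddCommGroup M] [Module R M] (p : ℕ) :
    KoszulModule s M (p + 1) →ₗ[R] KoszulModule s M p where
  toFun m J := ∑ i : {i : Fin s // i ∉ J.1}, (koszulSign R J.1 i.1 * f i.1) • m (J.insert i)
  map_add' m m' := by
    ext J
    simp [Finset.sum_add_distrib]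
  map_smul' a m := by
    ext J
    simp only [Pi.smul_apply, RingHom.id_apply, Finset.smul_sum]
    exact Finset.sum_congr rfl fun i _ => smul_comm _ _ _

/-- The Koszul differential on `e_I ⊗ m`. -/
theorem koszulD_single {p : ℕ} (f : Fin s → R) (I : Sub s (p + 1)) (m : M) :
    koszulD f M p (Pi.single I m) = ∑ i : {i // i ∈ I.1},
      Pi.single (⟨I.1.erase i, by rw [Finset.card_erase_of_mem i.2, I.2]; rfl⟩ : Sub s p)
        (((-1) ^ (I.1.filter (· < i.1)).card * f i.1) • m) := by
  funext J
  rw [Finset.sum_apply]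
  simp only [koszulD, LinearMap.coe_mk, AddHom.coe_mk, Pi.single_apply, smul_ite, smul_zero]
  rw [← Finset.sum_filter, ← Finset.sum_filter]
  refine Finset.sum_bij' (fun i hi => ⟨i.1, ?_⟩) (fun i hi => ⟨i.1, ?_⟩) ?_ ?_ ?_ ?_ ?_
  · simp at hi; rw [← hi]; simp [Sub.insert]
  · simp at hi; rw [hi]; simp
  · rintro ⟨i, h⟩ hi
    simp at hi; subst hi
    rw [Finset.mem_filter]
    exact ⟨Finset.mem_univ _, Subtype.ext (Finset.erase_insert h).symm⟩
  · rintro ⟨i, h⟩ hi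
    simp at hi; subst hi; simp [Sub.insert, Subtype.ext_iff, Finset.insert_erase h]
  · intros; rfl
  · intros; rfl
  · rintro ⟨i, h⟩ hi
    simp at hi; subst hi
    simp [Sub.insert, koszulSign, Finset.filter_insert]

theorem koszulSign_mul {s : ℕ} (J : Finset (Fin s)) {i k : Fin s} (hi : i ∉ J) (hk : k ∉ J)
    (hik : i ≠ k) :
    koszulSign R J i * koszulSign R (Insert.insert i J) k =
      -(koszulSign R J k * koszulSign R (Insert.insert k J) i) := by
  have key : ∀ {i k : Fin s}, i ∉ J → k ∉ J → i < k →
      koszulSign R J i * koszulSign R (Insert.insert i J) k =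
        -(koszulSign R J k * koszulSign R (Insert.insert k J) i) := by
    intro i k hi hk h
    unfold koszulSign
    rw [Finset.filter_insert, Finset.filter_insert, if_pos h, if_neg h.le.not_gt,
      Finset.card_insert_of_notMem (by simp [hi])]
    ring
  rcases lt_or_gt_of_ne hik with h | h
  · exact key hi hk h
  · rw [key hk hi h, neg_neg]

/-- The Koszul differentials form a complex. -/
theorem koszulD_comp (f : Fin s → R) (p : ℕ) : koszulD f M p ∘ₗ koszulD f M (p + 1) = 0 := by
  refine LinearMap.ext fun m => funext fun J => ?_
  simp only [LinearMap.comp_apply, koszulD, LinearMap.coe_mk, AddHom.coe_mk,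
    LinearMap.zero_apply, Pi.zero_apply, Finset.smul_sum]
  rw [Finset.sum_sigma']
  refine Finset.sum_involution
    (fun x _ => ⟨⟨x.2.1, fun h => x.2.2 (Finset.mem_insert_of_mem h)⟩, ⟨x.1.1, fun h => ?_⟩⟩)
    ?_ ?_ ?_ ?_
  · rcases Finset.mem_insert.1 h with h | h
    · exact x.2.2 (Finset.mem_insert.2 (Or.inl h.symm))
    · exact x.1.2 h
  · rintro ⟨⟨i, hi⟩, ⟨k, hk⟩⟩ -
    have hki : i ≠ k := fun h => hk (Finset.mem_insert.2 (Or.inl h.symm))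
    have hkJ : k ∉ J.1 := fun h => hk (Finset.mem_insert_of_mem h)
    have hs := koszulSign_mul (R := R) J.1 hi hkJ hki
    simp only [Sub.insert, smul_smul]
    simp only [Finset.insert_comm k i J.1]
    rw [← add_smul]
    convert zero_smul R _
    linear_combination f i * f k * hs
  · rintro ⟨⟨i, hi⟩, ⟨k, hk⟩⟩ - - h
    apply hk
    have := congrArg (fun x => x.1.1) h
    simp only at this
    exact Finset.mem_insert.2 (Or.inl this)
  · intro _ _
    exact Finset.mem_univ _
  · intro _ _
    rfl

section Grading

variable {A : Type*} [CommRing A] [Algebra A R] [Module A M] {q : ℕ}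

/-- The component `M_{ν - d}`, which is zero unless `d ≤ ν`. -/
def shiftGrading (ℳ : (Fin q → ℕ) → Submodule A M) (d ν : Fin q → ℕ) : Submodule A M :=
  ⨆ _ : d ≤ ν, ℳ (ν - d)

/-- The component of multidegree `ν` of `K_p(f, M)`, where `e_I ⊗ m` has multidegree
`∑ i ∈ I, d i + deg m`. -/
def koszulSlice (ℳ : (Fin q → ℕ) → Submodule A M) (d : Fin s → Fin q → ℕ) (ν : Fin q → ℕ)
    (p : ℕ) : Submodule A (KoszulModule s M p) :=
  Submodule.pi Set.univ fun I : Sub s p => shiftGrading ℳ (∑ i ∈ I.1, d i) ν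

theorem smul_mem_shiftGrading {𝒜 : (Fin q → ℕ) → Submodule A R}
    {ℳ : (Fin q → ℕ) → Submodule A M} [SetLike.GradedSMul 𝒜 ℳ] {a : R} {c d ν : Fin q → ℕ}
    (ha : a ∈ 𝒜 c) {m : M} (hm : m ∈ shiftGrading ℳ (c + d) ν) :
    a • m ∈ shiftGrading ℳ d ν := by
  unfold shiftGrading at hm ⊢
  by_cases h : c + d ≤ ν
  · have hd : d ≤ ν := le_trans le_add_self h
    simp only [h, iSup_pos] at hm
    simp only [hd, iSup_pos]
    have h1 := SetLike.GradedSMul.smul_mem ha hm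
    have h2 : c +ᵥ (ν - (c + d)) = ν - d := by
      ext p
      have := h p
      simp only [vadd_eq_add, Pi.add_apply, Pi.sub_apply] at this ⊢
      omega
    rwa [h2] at h1
  · simp only [h, iSup_false, Submodule.mem_bot] at hm
    rw [hm, smul_zero]
    exact Submodule.zero_mem _

variable [IsScalarTower A R M]

/-- The Koszul differential preserves the multigrading. -/
theorem koszulD_mem_slice (𝒜 : (Fin q → ℕ) → Submodule A R)
    (ℳ : (Fin q → ℕ) → Submodule A M) [SetLike.GradedSMul 𝒜 ℳ] {f : Fin s → R}
    {d : Fin s → Fin q → ℕ} (hf : ∀ i, f i ∈ 𝒜 (d i)) (ν : Fin q → ℕ) (p : ℕ)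
    (m : KoszulModule s M (p + 1)) (hm : m ∈ koszulSlice ℳ d ν (p + 1)) :
    (koszulD f M p).restrictScalars A m ∈ koszulSlice ℳ d ν p := by
  intro J _
  change ∑ i : {i : Fin s // i ∉ J.1}, (koszulSign R J.1 i.1 * f i.1) • m (J.insert i) ∈
    shiftGrading ℳ (∑ i ∈ J.1, d i) ν
  refine Submodule.sum_mem _ fun i _ => ?_
  have h1 : m (J.insert i) ∈ shiftGrading ℳ (∑ k ∈ (J.insert i).1, d k) ν :=
    hm (J.insert i) (Set.mem_univ _)
  have h2 : ∑ k ∈ (J.insert i).1, d k = d i.1 + ∑ k ∈ J.1, d k := Finset.sum_insert i.2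
  rw [h2] at h1
  have h3 := smul_mem_shiftGrading (hf i.1) h1
  rw [mul_smul]
  rcases neg_one_pow_eq_or R (J.1.filter (· < i.1)).card with h | h
  · simpa [koszulSign, h] using h3
  · simpa [koszulSign, h] using h3

/-- The differential `∂^ν_{p+1} : K^ν_{p+1}(f, M) → K^ν_p(f, M)` of the slice of multidegree
`ν`. -/
def koszulSliceD (𝒜 : (Fin q → ℕ) → Submodule A R)
    (ℳ : (Fin q → ℕ) → Submodule A M) [SetLike.GradedSMul 𝒜 ℳ] {f : Fin s → R}
    {d : Fin s → Fin q → ℕ} (hf : ∀ i, f i ∈ 𝒜 (d i)) (ν : Fin q → ℕ) (p : ℕ) :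
    koszulSlice ℳ d ν (p + 1) →ₗ[A] koszulSlice ℳ d ν p :=
  ((koszulD f M p).restrictScalars A).restrict (koszulD_mem_slice 𝒜 ℳ hf ν p)

end Grading

end Koszul

/-! ### Generic exactness and Cayley determinants

A complex `⋯ → C 2 → C 1 → C 0 → 0` is given by its modules and its maps
`∂ i : C (i + 1) → C i`. -/

section Cayley

variable {A : Type*} [CommRing A] [IsDomain A] {C : ℕ → Type*} [∀ i, AddCommGroup (C i)]
  [∀ i, Module A (C i)]

/-- The complex becomes exact, at every place, after tensoring with `Frac A`. -/
def IsGenericallyExact (D : ∀ i, C (i + 1) →ₗ[A] C i) : Prop :=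
  Function.Surjective ((D 0).baseChange (FractionRing A)) ∧
    ∀ i, Function.Exact ((D (i + 1)).baseChange (FractionRing A))
      ((D i).baseChange (FractionRing A))

/-- A choice of bases and partitions that computes the Cayley determinant of a complex
`0 → C s → ⋯ → C 0 → 0`. The basis of `C i` is indexed by `Fin (k i)`, the part `u'_i` of the
basis is given by the indices in `S i`, the part `u''_i` by the other indices. -/
structure CayleyData (D : ∀ i, C (i + 1) →ₗ[A] C i) (s : ℕ) where
  k : ℕ → ℕ
  basis : ∀ i, Module.Basis (Fin (k i)) A (C i)
  S : ∀ i, Finset (Fin (k i))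
  S_zero : S 0 = Finset.univ
  S_top : S s = ∅
  /-- An ordering of rows and columns that makes `φ_{i+1}` a square matrix; the choice affects
  the determinant by a sign only. -/
  e : ∀ i : Fin s, {j // j ∈ S i} ≃ {j // j ∉ S (i + 1)}
  /-- The block of the matrix of `D i` with columns in `u''_{i+1}` and rows in `u'_i`. -/
  φ : ∀ i : Fin s, Matrix {j // j ∈ S i} {j // j ∈ S i} A
  φ_eq : ∀ i a b, φ i a b = (basis i).repr (D i (basis (i + 1) (e i b).1)) a.1
  det_ne_zero : ∀ i, (φ i).det ≠ 0

/-- The Cayley determinant `∏_{i = 1}^{s} det(φ_i)^{(-1)^{i + 1}}` with respect to the given bases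
and partitions; the block `φ_{i+1}` is numbered by `i`. -/
noncomputable def CayleyData.det {D : ∀ i, C (i + 1) →ₗ[A] C i} {s : ℕ} (c : CayleyData D s) :
    FractionRing A :=
  ∏ i : Fin s, (algebraMap A (FractionRing A) (c.φ i).det) ^ ((-1 : ℤ) ^ (i : ℕ))

end Cayley

/-! ### Contents of torsion modules -/

section Content

/-- A choice of representatives, up to units, of the irreducible elements. -/
structure IrrReps (A : Type*) [CommRing A] where
  carrier : Set A
  irreducible : ∀ π ∈ carrier, Irreducible π
  existsUnique : ∀ a : A, Irreducible a → ∃! π, π ∈ carrier ∧ Associated a π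

variable {A : Type*} [CommRing A] [IsDomain A] [UniqueFactorizationMonoid A]

/-- The ideal generated by an irreducible element. -/
def IrrReps.ideal (P : IrrReps A) (π : P.carrier) : Ideal A := Ideal.span {(π : A)}

instance (P : IrrReps A) (π : P.carrier) : (P.ideal π).IsPrime :=
  (Ideal.span_singleton_prime (P.irreducible π π.2).ne_zero).2 (P.irreducible π π.2).prime

/-- The length of the localization `N_{(π)}` over `A_{(π)}`. -/
noncomputable def IrrReps.localLength (P : IrrReps A) (N : Type*) [AddCommGroup N] [Module A N]
    (π : P.carrier) : ℕ∞ :=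
  Module.length (Localization.AtPrime (P.ideal π)) (LocalizedModule (P.ideal π).primeCompl N)

/-- The content `∏_π π ^ ℓ(N_{(π)})` of a finitely generated torsion module `N`. -/
noncomputable def content (P : IrrReps A) (N : Type*) [AddCommGroup N] [Module A N] : A :=
  ∏ᶠ π : P.carrier, (π : A) ^ (P.localLength N π).toNat

end Content

end MultiKoszul

/-! Write `N` for the component of multidegree `ν` of `M / (f) M`, with `ν` large. The proof has
three independent ingredients.

Acyclicity. Filter-regularity holds over `A` and not merely over `K`, so the usual induction on the
number of `f_i` kills the positive homology of the Koszul complex over `A` itself, in large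
multidegrees (`eventually_exists_totalD_eq`). Hence the slice is a finite free resolution of `N`.

Torsion. Multiplication by `f_i` is eventually injective on the successive quotients, so passing to
the next quotient replaces the rank function `Q(ν)` by `Q(ν) - Q(ν - d_i)`
(`finrank_quotGrading_succ`). Such a difference is zero or of smaller total degree
(`sub_translate_eq_zero_or`). After `r + 1` steps nothing is left of a polynomial of degree `r`, so
`N` has rank zero, and the resolution becomes exact over `K`.

Determinant. Put `Q_i = C_i / (⟨u''_i⟩ + im D_i)`, where `D_i : C_{i+1} → C_i`. Then `Q_0 = N`
because `u''_0` is empty, and `Q_s = 0` because `u''_s` is the whole basis. The cokernel of the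
block of `D_i` is an extension with pieces `Q_{i+1}` and `Q_i` (`lengthAt_quot_φ`). At a prime
element `π` its length is the `π`-adic valuation of the determinant of the block
(`lengthAt_quot_range_mulVecLin`). By unique factorization that determinant is `χ(Q_i) χ(Q_{i+1})`
up to a unit, and the alternating product telescopes to `χ(Q_0) = χ(N)` (`prod_alternating_zpow`).
Admissible partitions exist by choosing maximal independent sets of columns, one differential after
another (`IsComplementary.exists_succ`). -/

namespace MultiKoszul

/-! ### Lengths of localizations and their additivity. -/

section LocalLength

variable {A : Type*} [CommRing A]

/-- The length of the localization of `N` at the prime `p`. -/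
noncomputable def lengthAt (p : Ideal A) [p.IsPrime] (N : Type*) [AddCommGroup N] [Module A N] :
    ℕ∞ :=
  Module.length (Localization.AtPrime p) (LocalizedModule p.primeCompl N)

variable (p : Ideal A) [p.IsPrime] {X Y Z : Type*} [AddCommGroup X] [AddCommGroup Y]
  [AddCommGroup Z] [Module A X] [Module A Y] [Module A Z]

theorem lengthAt_eq_add_of_exact (f : X →ₗ[A] Y) (g : Y →ₗ[A] Z) (hf : Function.Injective f)
    (hg : Function.Surjective g) (h : Function.Exact f g) :
    lengthAt p Y = lengthAt p X + lengthAt p Z :=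
  Module.length_eq_add_of_exact (LocalizedModule.map p.primeCompl f)
    (LocalizedModule.map p.primeCompl g)
    (LocalizedModule.map_injective _ f hf) (LocalizedModule.map_surjective _ g hg)
    (LocalizedModule.map_exact p.primeCompl f g h)

theorem lengthAt_congr (e : X ≃ₗ[A] Y) : lengthAt p X = lengthAt p Y :=
  le_antisymm
    (Module.length_le_of_injective (LocalizedModule.map p.primeCompl e.toLinearMap)
      (LocalizedModule.map_injective _ _ e.injective))
    (Module.length_le_of_injective (LocalizedModule.map p.primeCompl e.symm.toLinearMap)
      (LocalizedModule.map_injective _ _ e.symm.injective))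

theorem lengthAt_eq_zero [Subsingleton X] : lengthAt p X = 0 :=
  Module.length_eq_zero

/-- The cokernel of `g` restricted to `W` is an extension of the cokernel of `g` by
`X / (W + ker g)`. -/
theorem lengthAt_quot_map (g : X →ₗ[A] Y) (W : Submodule A X) :
    lengthAt p (Y ⧸ W.map g) =
      lengthAt p (X ⧸ W ⊔ LinearMap.ker g) + lengthAt p (Y ⧸ LinearMap.range g) := by
  refine lengthAt_eq_add_of_exact p
    (Submodule.mapQ (W ⊔ LinearMap.ker g) (W.map g) g ?_)
    (Submodule.factor (LinearMap.map_le_range : W.map g ≤ _)) ?_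
    (Submodule.factor_surjective _) ?_
  · rw [sup_le_iff]
    exact ⟨Submodule.le_comap_map _ _, fun x hx => by simp [LinearMap.mem_ker.1 hx]⟩
  · rw [← LinearMap.ker_eq_bot, LinearMap.ker_eq_bot']
    intro x
    induction x using Submodule.Quotient.induction_on with | _ x
    intro hx
    rw [Submodule.mapQ_apply, Submodule.Quotient.mk_eq_zero] at hx
    obtain ⟨w, hw, hwx⟩ := hx
    rw [Submodule.Quotient.mk_eq_zero, Submodule.mem_sup]
    exact ⟨w, hw, x - w, by simp [hwx], by simp⟩
  · intro y
    induction y using Submodule.Quotient.induction_on with | _ y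
    constructor
    · intro hy
      have hy' : y ∈ LinearMap.range g := by
        rw [← Submodule.Quotient.mk_eq_zero]; exact hy
      obtain ⟨x, rfl⟩ := hy'
      exact ⟨Submodule.Quotient.mk x, rfl⟩
    · rintro ⟨x, hx⟩
      induction x using Submodule.Quotient.induction_on with | _ x
      rw [← hx]
      change Submodule.Quotient.mk (g x) = 0
      rw [Submodule.Quotient.mk_eq_zero]
      exact ⟨x, rfl⟩

end LocalLength

/-! ### Cokernels of square matrices over a discrete valuation ring and at a prime element. -/

section DVR

/-- Over a discrete valuation ring, the length of the cokernel of a square matrix is the valuation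
of its determinant. -/
theorem length_quot_range_mulVecLin {R : Type*} [CommRing R] [IsDomain R]
    [IsDiscreteValuationRing R] {ι : Type*} [Fintype ι] [DecidableEq ι] (φ : Matrix ι ι R)
    (hφ : φ.det ≠ 0) :
    Module.length R ((ι → R) ⧸ LinearMap.range φ.mulVecLin) =
      IsDiscreteValuationRing.addVal R φ.det := by
  have hinj : Function.Injective φ.mulVecLin := Matrix.mulVec_injective_of_det_ne_zero hφ
  let N := LinearMap.range φ.mulVecLin
  let e : (ι → R) ≃ₗ[R] N := LinearEquiv.ofInjective _ hinj
  let b := Pi.basisFun R ι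
  have h : Module.finrank R N = Module.finrank R (ι → R) := e.symm.finrank_eq
  let a := Submodule.smithNormalFormCoeffs b h
  let b' := Submodule.smithNormalFormTopBasis b h
  let ab := Submodule.smithNormalFormBotBasis b h
  have ab_eq := Submodule.smithNormalFormBotBasis_def b h
  let e' : (ι → R) ≃ₗ[R] N := b'.equiv ab (Equiv.refl _)
  let f : (ι → R) →ₗ[R] (ι → R) := N.subtype.comp (e' : (ι → R) →ₗ[R] N)
  have ha : ∀ i, f (b' i) = a i • b' i := by
    intro i
    change ((b'.equiv ab (Equiv.refl _) (b' i) : N) : ι → R) = _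
    rw [b'.equiv_apply, Equiv.refl_apply]
    exact ab_eq i
  have hdet : LinearMap.det f = ∏ i, a i := by
    rw [← LinearMap.det_toMatrix b', ← Matrix.det_diagonal]
    congr 1
    ext i j
    rw [LinearMap.toMatrix_apply, ha, map_smul, Module.Basis.repr_self, Finsupp.smul_single,
      smul_eq_mul, mul_one]
    by_cases h : i = j
    · rw [h, Matrix.diagonal_apply_eq, Finsupp.single_eq_same]
    · rw [Matrix.diagonal_apply_ne _ h, Finsupp.single_eq_of_ne h]
  -- Both maps are the inclusion of the image `N` preceded by an isomorphism onto it, so they differ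
  -- by an automorphism of the source.
  have hassoc : Associated φ.det (∏ i, a i) := by
    rw [← hdet, ← LinearMap.det_toLin' φ]
    have : Matrix.toLin' φ = N.subtype ∘ₗ (e : (ι → R) →ₗ[R] N) := by
      ext; rfl
    rw [this]
    exact LinearMap.associated_det_comp_equiv _ _ _
  rw [(Submodule.quotientEquivPiSpan N b h).length_eq, Module.length_pi_of_fintype]
  rw [(IsDiscreteValuationRing.addVal_eq_iff_associated _ _).2 hassoc]
  have : ∀ i, Module.length R (R ⧸ Ideal.span {a i}) = IsDiscreteValuationRing.addVal R (a i) :=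
    fun i => Ring.ord_eq_addVal (a i)
  change ∑ i, Module.length R (R ⧸ Ideal.span {a i}) = _
  simp only [this]
  induction (Finset.univ : Finset ι) using Finset.induction_on with
  | empty => simp
  | insert i s hi ih =>
    rw [Finset.sum_insert hi, Finset.prod_insert hi, IsDiscreteValuationRing.addVal_mul, ih]

variable {A : Type*} [CommRing A] [IsDomain A] [IsNoetherianRing A]

theorem isDiscreteValuationRing_atPrime_span {π : A} (hπ : Prime π)
    [(Ideal.span {π}).IsPrime] :
    IsDiscreteValuationRing (Localization.AtPrime (Ideal.span {π})) := by
  have hmax : IsLocalRing.maximalIdeal (Localization.AtPrime (Ideal.span {π})) =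
      Ideal.span {algebraMap A _ π} := by
    rw [← Localization.AtPrime.map_eq_maximalIdeal, Ideal.map_span, Set.image_singleton]
  have hle : (Ideal.span {π}).primeCompl ≤ nonZeroDivisors A :=
    Ideal.primeCompl_le_nonZeroDivisors _
  have hne : algebraMap A (Localization.AtPrime (Ideal.span {π})) π ≠ 0 := by
    rw [ne_eq, IsLocalization.to_map_eq_zero_iff _ hle]
    exact hπ.ne_zero
  have hfield : ¬ IsField (Localization.AtPrime (Ideal.span {π})) := by
    rw [IsLocalRing.isField_iff_maximalIdeal_eq, hmax, Ideal.span_singleton_eq_bot]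
    exact hne
  have hN : IsNoetherianRing (Localization.AtPrime (Ideal.span {π})) :=
    IsLocalization.isNoetherianRing (Ideal.span {π}).primeCompl _ inferInstance
  have hprin : (IsLocalRing.maximalIdeal
      (Localization.AtPrime (Ideal.span {π}))).IsPrincipal := ⟨⟨_, hmax⟩⟩
  exact ((IsDiscreteValuationRing.TFAE (Localization.AtPrime (Ideal.span {π})) hfield).out 0 4).2
    hprin

theorem addVal_algebraMap_atPrime_span {π : A} (hπ : Prime π) [(Ideal.span {π}).IsPrime]
    [IsDiscreteValuationRing (Localization.AtPrime (Ideal.span {π}))] {a : A} (ha : a ≠ 0) :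
    IsDiscreteValuationRing.addVal (Localization.AtPrime (Ideal.span {π}))
      (algebraMap A _ a) = emultiplicity π a := by
  have hfin : FiniteMultiplicity π a := FiniteMultiplicity.of_prime_left hπ ha
  obtain ⟨b, hb, hndvd⟩ := hfin.exists_eq_pow_mul_and_not_dvd
  have hunit : IsUnit (algebraMap A (Localization.AtPrime (Ideal.span {π})) b) :=
    IsLocalization.map_units _ (⟨b, fun h => hndvd (Ideal.mem_span_singleton.1 h)⟩ :
      (Ideal.span {π}).primeCompl)
  have hmax : IsLocalRing.maximalIdeal (Localization.AtPrime (Ideal.span {π})) =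
      Ideal.span {algebraMap A _ π} := by
    rw [← Localization.AtPrime.map_eq_maximalIdeal, Ideal.map_span, Set.image_singleton]
  have hirr : Irreducible (algebraMap A (Localization.AtPrime (Ideal.span {π})) π) :=
    (IsDiscreteValuationRing.irreducible_iff_uniformizer _).2 hmax
  rw [hfin.emultiplicity_eq_multiplicity]
  conv_lhs => rw [hb]
  rw [map_mul, map_pow, mul_comm, ← hunit.unit_spec,
    IsDiscreteValuationRing.addVal_def' hunit.unit hirr]

/-- Localization is exact, so the localized cokernel is the cokernel of the same matrix over the
discrete valuation ring `A_(π)`, whose valuation restricts to the multiplicity of `π` on nonzero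
elements of `A`. -/
theorem lengthAt_quot_range_mulVecLin {π : A} (hπ : Prime π) [(Ideal.span {π}).IsPrime]
    {ι : Type*} [Fintype ι] [DecidableEq ι] (φ : Matrix ι ι A) (hφ : φ.det ≠ 0) :
    lengthAt (Ideal.span {π}) ((ι → A) ⧸ LinearMap.range φ.mulVecLin) =
      emultiplicity π φ.det := by
  let p : Ideal A := Ideal.span {π}
  let S := p.primeCompl
  let R := Localization.AtPrime p
  have : IsDiscreteValuationRing R := isDiscreteValuationRing_atPrime_span hπ
  let j : (ι → A) →ₗ[A] (ι → R) := (Algebra.linearMap A R).compLeft ι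
  have : IsLocalizedModule S j := inferInstanceAs
    (IsLocalizedModule S (.pi fun i => Algebra.linearMap A R ∘ₗ .proj i))
  let N := LinearMap.range φ.mulVecLin
  let ψ : Matrix ι ι R := φ.map (algebraMap A R)
  have hψdet : ψ.det = algebraMap A R φ.det := (RingHom.map_det (algebraMap A R) φ).symm
  have hψ : ψ.det ≠ 0 := by
    rw [hψdet, ne_eq, IsLocalization.to_map_eq_zero_iff R (Ideal.primeCompl_le_nonZeroDivisors p)]
    exact hφ
  have hmap : IsLocalizedModule.map S j j φ.mulVecLin = ψ.mulVecLin.restrictScalars A := by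
    refine IsLocalizedModule.ext S j (IsLocalizedModule.map_units j) ?_
    ext i k
    simp [j, ψ, Matrix.mulVec_single, Matrix.mulVec, dotProduct, Pi.single_apply]
  let G : (ι → R) →ₗ[R] LocalizedModule S ((ι → A) ⧸ N) :=
    IsLocalizedModule.mapExtendScalars S j (LocalizedModule.mkLinearMap S _) R N.mkQ
  have hGsurj : Function.Surjective G :=
    IsLocalizedModule.map_surjective S j (LocalizedModule.mkLinearMap S _) N.mkQ N.mkQ_surjective
  have hex : Function.Exact ψ.mulVecLin G := by
    have := IsLocalizedModule.map_exact S j j (LocalizedModule.mkLinearMap S _) φ.mulVecLin N.mkQ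
      (LinearMap.exact_map_mkQ_range _)
    rw [hmap] at this
    exact this
  rw [← addVal_algebraMap_atPrime_span hπ hφ, ← hψdet, ← length_quot_range_mulVecLin ψ hψ]
  have e := G.quotKerEquivOfSurjective hGsurj
  rw [LinearMap.exact_iff.1 hex] at e
  exact e.symm.length_eq

end DVR

/-! ### Multiplicities of primes and contents over a factorial ring. -/

section Factorial

variable {A : Type*} [CommRing A]

theorem IrrReps.eq_of_associated (P : IrrReps A) {π ρ : P.carrier}
    (h : Associated (π : A) (ρ : A)) : π = ρ :=
  Subtype.ext ((P.existsUnique π (P.irreducible π π.2)).unique ⟨π.2, Associated.refl _⟩ ⟨ρ.2, h⟩)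

variable [UniqueFactorizationMonoid A]

theorem IrrReps.prime (P : IrrReps A) (π : P.carrier) : Prime (π : A) :=
  (P.irreducible π π.2).prime

theorem IrrReps.finite_dvd (P : IrrReps A) {a : A} (ha : a ≠ 0) :
    {π : P.carrier | (π : A) ∣ a}.Finite := by
  have h : ∀ π : {π : P.carrier | (π : A) ∣ a}, ∃ q : {q // q ∈ UniqueFactorizationMonoid.factors a},
      Associated (π.1 : A) q := fun π => by
    obtain ⟨q, hq, hπ⟩ := UniqueFactorizationMonoid.exists_mem_factors_of_dvd ha
      (P.irreducible π.1 π.1.2) π.2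
    exact ⟨⟨q, hq⟩, hπ⟩
  choose g hg using h
  have : Finite {q // q ∈ UniqueFactorizationMonoid.factors a} :=
    (Multiset.finite_toSet _).to_subtype
  exact Finite.of_injective g fun π ρ hπρ => Subtype.ext
    (P.eq_of_associated ((hg π).trans ((hπρ ▸ Associated.refl _ :
      Associated (g π : A) (g ρ)).trans (hg ρ).symm)))

theorem content_eq_one (P : IrrReps A) {N : Type*} [AddCommGroup N] [Module A N]
    [Subsingleton N] : content P N = 1 := by
  have : ∀ π, P.localLength N π = 0 := fun π => lengthAt_eq_zero (P.ideal π)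
  simp [content, this]

theorem content_congr (P : IrrReps A) {N N' : Type*} [AddCommGroup N] [Module A N]
    [AddCommGroup N'] [Module A N'] (e : N ≃ₗ[A] N') :
    content P N = content P N' := by
  have : ∀ π, P.localLength N π = P.localLength N' π := fun π => lengthAt_congr (P.ideal π) e
  simp [content, this]

variable [IsDomain A]

theorem dvd_of_emultiplicity_le {a b : A} (ha : a ≠ 0)
    (h : ∀ π : A, Prime π → emultiplicity π a ≤ emultiplicity π b) : a ∣ b := by
  induction a using UniqueFactorizationMonoid.induction_on_prime generalizing b with
  | h₁ => exact absurd rfl ha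
  | h₂ x hx => exact hx.dvd
  | h₃ a p ha' hp ih =>
    have hpb : p ∣ b := by
      rw [← emultiplicity_ne_zero]
      have h1 := h p hp
      intro h0
      rw [h0, nonpos_iff_eq_zero, emultiplicity_eq_zero] at h1
      exact h1 (dvd_mul_right p a)
    obtain ⟨b, rfl⟩ := hpb
    refine mul_dvd_mul_left p (ih ha' fun π hπ => ?_)
    have h1 := h π hπ
    rw [emultiplicity_mul hπ, emultiplicity_mul hπ] at h1
    have hfin : emultiplicity π p ≠ ⊤ :=
      finiteMultiplicity_iff_emultiplicity_ne_top.1 (FiniteMultiplicity.of_prime_left hπ hp.ne_zero)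
    exact (ENat.add_le_add_iff_left hfin).1 h1

theorem associated_of_emultiplicity_eq {a b : A} (ha : a ≠ 0) (hb : b ≠ 0)
    (h : ∀ π : A, Prime π → emultiplicity π a = emultiplicity π b) : Associated a b :=
  associated_of_dvd_dvd (dvd_of_emultiplicity_le ha fun π hπ => (h π hπ).le)
    (dvd_of_emultiplicity_le hb fun π hπ => (h π hπ).ge)

theorem IrrReps.associated_of_emultiplicity_eq (P : IrrReps A) {a b : A} (ha : a ≠ 0) (hb : b ≠ 0)
    (h : ∀ π : P.carrier, emultiplicity (π : A) a = emultiplicity (π : A) b) :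
    Associated a b := by
  refine MultiKoszul.associated_of_emultiplicity_eq ha hb fun ρ hρ => ?_
  obtain ⟨π, hπ, hρπ⟩ := (P.existsUnique ρ hρ.irreducible).exists
  rw [← emultiplicity_eq_of_associated_left hρπ, ← emultiplicity_eq_of_associated_left hρπ]
  exact h ⟨π, hπ⟩

variable (P : IrrReps A) (N : Type*) [AddCommGroup N] [Module A N]

theorem content_ne_zero : content P N ≠ 0 :=
  finprod_induction (fun x : A => x ≠ 0) one_ne_zero (fun _ _ => mul_ne_zero)
    fun π => pow_ne_zero _ (P.prime π).ne_zero

variable {N}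

/-- The auxiliary `a` guards against default values: it makes every local length finite, where
`toNat` would read `⊤` as `0`, and all but finitely many of them zero, where `finprod` would
otherwise return `1`. -/
theorem emultiplicity_content {a : A} (ha : a ≠ 0)
    (h : ∀ π : P.carrier, P.localLength N π ≤ emultiplicity (π : A) a) (π : P.carrier) :
    emultiplicity (π : A) (content P N) = P.localLength N π := by
  classical
  have hfin : ∀ ρ : P.carrier, P.localLength N ρ ≠ ⊤ := fun ρ => ne_top_of_le_ne_top
    (finiteMultiplicity_iff_emultiplicity_ne_top.1
      (FiniteMultiplicity.of_prime_left (P.prime ρ) ha)) (h ρ)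
  -- The element `π` is added by hand so that the product contains its factor even when `π` does not
  -- divide `a`.
  have hsupp : Function.mulSupport
      (fun ρ : P.carrier => (ρ : A) ^ (P.localLength N ρ).toNat) ⊆
      ((P.finite_dvd ha).toFinset ∪ {π} : Finset P.carrier) := by
    intro ρ hρ
    rw [Finset.coe_union, Set.Finite.coe_toFinset]
    left
    by_contra hnd
    have h0 := h ρ
    rw [emultiplicity_eq_zero.2 hnd, nonpos_iff_eq_zero] at h0
    exact hρ (by simp [h0])
  rw [content, finprod_eq_prod_of_mulSupport_subset _ hsupp, Finset.emultiplicity_prod (P.prime π),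
    Finset.sum_eq_single π]
  · rw [emultiplicity_pow_self (P.prime π).ne_zero (P.prime π).not_isUnit,
      ENat.natCast_toNat (hfin π)]
  · intro ρ _ hρ
    rw [emultiplicity_pow (P.prime π), emultiplicity_eq_zero.2, mul_zero]
    intro hdvd
    exact hρ (P.eq_of_associated
      ((P.prime π).irreducible.associated_of_dvd (P.prime ρ).irreducible hdvd)).symm
  · intro hπ
    simp at hπ

theorem associated_content_mul {N' : Type*} [AddCommGroup N'] [Module A N'] {a : A} (ha : a ≠ 0)
    (h : ∀ π : P.carrier, emultiplicity (π : A) a = P.localLength N π + P.localLength N' π) :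
    Associated a (content P N * content P N') := by
  refine P.associated_of_emultiplicity_eq ha
    (mul_ne_zero (content_ne_zero P N) (content_ne_zero P N')) fun π => ?_
  rw [emultiplicity_mul (P.prime π), h π,
    emultiplicity_content P ha (fun π => by rw [h π]; exact le_self_add),
    emultiplicity_content P ha (fun π => by rw [h π]; exact le_add_self)]

end Factorial

/-! ### Telescoping of alternating products. -/

section Telescope

variable {A : Type*} [CommRing A] [IsDomain A]

/-- Each `β i` with `0 < i < s` occurs in two neighbouring factors with opposite exponents. The
surviving power of `β s` is kept on the left so that the claim can be proved by induction on `s`. -/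
theorem prod_alternating_zpow {s : ℕ} (α : Fin s → A) (β : ℕ → A) (hβ : ∀ i, β i ≠ 0)
    (h : ∀ i : Fin s, Associated (α i) (β i * β (i + 1))) :
    ∃ u : Aˣ, (∏ i : Fin s, (algebraMap A (FractionRing A) (α i)) ^ ((-1 : ℤ) ^ (i : ℕ))) *
        algebraMap A (FractionRing A) (β s) ^ ((-1 : ℤ) ^ s) =
      algebraMap A (FractionRing A) (u * β 0) := by
  induction s with
  | zero => exact ⟨1, by simp⟩
  | succ s ih =>
    obtain ⟨u, hu⟩ := ih (fun i => α i.castSucc) (fun i => h i.castSucc)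
    obtain ⟨w, hw⟩ := (h (Fin.last s)).symm
    have hβ' : ∀ i, algebraMap A (FractionRing A) (β i) ≠ 0 := fun i => by
      rw [ne_eq, IsFractionRing.to_map_eq_zero_iff]; exact hβ i
    have hwz : algebraMap A (FractionRing A) w ≠ 0 := by
      rw [ne_eq, IsFractionRing.to_map_eq_zero_iff]; exact w.ne_zero
    have hcancel : ∀ x y z : FractionRing A, y ≠ 0 → z ≠ 0 →
        (x * y * z) ^ ((-1 : ℤ) ^ s) * y ^ ((-1 : ℤ) ^ (s + 1)) =
          z ^ ((-1 : ℤ) ^ s) * x ^ ((-1 : ℤ) ^ s) := by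
      intro x y z hy hz
      rw [mul_zpow, mul_zpow, pow_succ (-1 : ℤ) s, mul_neg_one, zpow_neg]
      have : y ^ ((-1 : ℤ) ^ s) ≠ 0 := zpow_ne_zero _ hy
      field_simp
    -- Powers with negative exponents are taken in the unit group of `A`, so the error factor
    -- remains a unit of `A`.
    have hunit : ∃ w' : Aˣ, algebraMap A (FractionRing A) w ^ ((-1 : ℤ) ^ s) =
        algebraMap A (FractionRing A) w' := by
      refine ⟨w ^ ((-1 : ℤ) ^ s), ?_⟩
      change ((Units.map (algebraMap A (FractionRing A)).toMonoidHom w :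
        (FractionRing A)ˣ) : FractionRing A) ^ ((-1 : ℤ) ^ s) = _
      rw [← Units.val_zpow_eq_zpow_val, ← map_zpow]
      rfl
    obtain ⟨w', hw'⟩ := hunit
    refine ⟨u * w', ?_⟩
    rw [Fin.prod_univ_castSucc, mul_assoc]
    simp only [Fin.val_last, Fin.val_castSucc] at hw ⊢
    rw [← hw, map_mul, map_mul, hcancel _ _ _ (hβ' _) hwz, hw', mul_left_comm, hu, ← map_mul]
    push_cast
    ring_nf

end Telescope

/-! ### The Cayley determinant of a free resolution. -/

section CayleyDet

variable {A : Type*} [CommRing A] {C : ℕ → Type*} [∀ i, AddCommGroup (C i)]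
  [∀ i, Module A (C i)] {D : ∀ i, C (i + 1) →ₗ[A] C i} {s : ℕ}

/-- The coordinates with respect to a part of a basis. -/
noncomputable def coords {X : Type*} [AddCommGroup X] [Module A X] {ι : Type*} [Finite ι]
    (b : Module.Basis ι A X) (S : Finset ι) : X →ₗ[A] ({j // j ∈ S} → A) :=
  LinearMap.funLeft A A Subtype.val ∘ₗ b.equivFun.toLinearMap

theorem coords_apply {X : Type*} [AddCommGroup X] [Module A X] {ι : Type*} [Finite ι]
    (b : Module.Basis ι A X) (S : Finset ι) (x : X) (j : {j // j ∈ S}) :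
    coords b S x j = b.repr x j := rfl

theorem coords_surjective {X : Type*} [AddCommGroup X] [Module A X] {ι : Type*} [Finite ι]
    (b : Module.Basis ι A X) (S : Finset ι) : Function.Surjective (coords b S) := by
  rw [coords, LinearMap.coe_comp]
  exact (LinearMap.funLeft_surjective_of_injective A A _ Subtype.val_injective).comp
    b.equivFun.surjective

/-- A vector whose coordinates in `S` vanish is a combination of the other basis vectors. -/
theorem sum_eq_of_coords_eq_zero {X : Type*} [AddCommGroup X] [Module A X] {ι κ : Type*}
    [Fintype ι] [Fintype κ] (b : Module.Basis ι A X) (S : Finset ι) (e : κ ≃ {j // j ∉ S}) {x : X}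
    (hx : coords b S x = 0) : ∑ k, b.repr x (e k) • b (e k) = x := by
  classical
  conv_rhs => rw [← b.sum_repr x]
  rw [e.sum_comp (fun j : {j // j ∉ S} => b.repr x j • b j)]
  rw [← Finset.sum_subtype (Finset.univ.filter fun j => j ∉ S) (by simp)
    (fun j => b.repr x j • b j)]
  refine Finset.sum_subset (Finset.subset_univ _) fun j _ hj => ?_
  have hjS : j ∈ S := by simpa using hj
  have : b.repr x j = 0 := congrFun hx ⟨j, hjS⟩
  rw [this, zero_smul]

theorem coords_sum_eq_zero {X : Type*} [AddCommGroup X] [Module A X] {ι κ : Type*}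
    [Finite ι] [Fintype κ] (b : Module.Basis ι A X) (S : Finset ι) (e : κ ≃ {j // j ∉ S})
    (v : κ → A) : coords b S (∑ k, v k • b (e k)) = 0 := by
  classical
  funext j
  rw [coords_apply, map_sum, Finsupp.finsetSum_apply]
  refine Finset.sum_eq_zero fun k _ => ?_
  have : (e k : ι) ≠ j := fun h => (e k).2 (h ▸ j.2)
  simp [this]

namespace CayleyData

variable (c : CayleyData D s)

/-- The projection of `C i` to the span of `u'_i`. -/
noncomputable def proj (i : ℕ) : C i →ₗ[A] ({j // j ∈ c.S i} → A) := coords (c.basis i) (c.S i)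

theorem mem_S_zero (j : Fin (c.k 0)) : j ∈ c.S 0 := by
  rw [c.S_zero]
  exact Finset.mem_univ j

theorem φ_mulVec (i : Fin s) (v : {j // j ∈ c.S i} → A) :
    (c.φ i).mulVec v = c.proj i (D i (∑ b, v b • c.basis (i + 1) (c.e i b))) := by
  funext a
  rw [map_sum, map_sum, Finset.sum_apply, Matrix.mulVec, dotProduct]
  refine Finset.sum_congr rfl fun b _ => ?_
  rw [c.φ_eq, map_smul, map_smul, Pi.smul_apply, smul_eq_mul, mul_comm]
  rfl

/-- The kernel of `c.proj (i + 1)` is the span of `u''_{i+1}`, the columns of the block. This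
removes matrices and orderings from the rest of the argument. -/
theorem range_φ (i : Fin s) : LinearMap.range (c.φ i).mulVecLin =
    (LinearMap.ker (c.proj (i + 1))).map (c.proj i ∘ₗ D i) := by
  ext y
  constructor
  · rintro ⟨v, rfl⟩
    exact ⟨_, coords_sum_eq_zero (c.basis (i + 1)) (c.S (i + 1)) (c.e i) v,
      (c.φ_mulVec i v).symm⟩
  · rintro ⟨x, hx, rfl⟩
    refine ⟨fun b => (c.basis (i + 1)).repr x (c.e i b), ?_⟩
    rw [Matrix.mulVecLin_apply, c.φ_mulVec,
      sum_eq_of_coords_eq_zero (c.basis (i + 1)) (c.S (i + 1)) (c.e i) hx]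
    rfl

variable [IsDomain A]

theorem eq_zero_of_proj_eq_zero (i : Fin s) {x : C (i + 1)} (hx : c.proj (i + 1) x = 0)
    (h : D i x = 0) : x = 0 := by
  have h1 := sum_eq_of_coords_eq_zero (c.basis (i + 1)) (c.S (i + 1)) (c.e i) hx
  have h2 := c.φ_mulVec i fun b => (c.basis (i + 1)).repr x (c.e i b)
  rw [h1, h, map_zero] at h2
  have h3 := Matrix.eq_zero_of_mulVec_eq_zero (c.det_ne_zero i) h2
  rw [← h1]
  exact Finset.sum_eq_zero fun b _ => by rw [congrFun h3 b, Pi.zero_apply, zero_smul]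

/-- The projection to `u'_i` is injective on boundaries. For `i = 0` it forgets no coordinate. For
larger `i` a boundary is a cycle, and a cycle in the span of `u''_i` vanishes because the preceding
block is nonsingular. -/
theorem ker_proj_comp (hD : ∀ i, Function.Exact (D (i + 1)) (D i)) (i : ℕ) (hi : i < s) :
    LinearMap.ker (c.proj i ∘ₗ D i) = LinearMap.range (D (i + 1)) := by
  rw [← LinearMap.exact_iff.1 (hD i)]
  ext x
  rw [LinearMap.mem_ker, LinearMap.mem_ker, LinearMap.comp_apply]
  refine ⟨fun hx => ?_, fun hx => by rw [hx, map_zero]⟩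
  cases i with
  | zero =>
    have h := sum_eq_of_coords_eq_zero (c.basis 0) (c.S 0) (Equiv.refl _) hx
    rw [← h]
    exact Finset.sum_eq_zero fun b _ => absurd (c.mem_S_zero b.1) b.2
  | succ i =>
    exact c.eq_zero_of_proj_eq_zero ⟨i, by omega⟩ hx ((hD i).apply_apply_eq_zero x)

/-- The quotient of `C i` by the span of `u''_i` and the boundaries. -/
abbrev Quot (i : ℕ) : Type _ := C i ⧸ LinearMap.ker (c.proj i) ⊔ LinearMap.range (D i)

/-- The image of the block comes from `⟨u''_{i+1}⟩` by `D i` followed by the projection. Applying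
`lengthAt_quot_map` to the composite yields `Q_{i+1}`, the kernel being the boundaries; applying it
to the projection yields `Q_i`, the projection being onto. -/
theorem lengthAt_quot_φ (hD : ∀ i, Function.Exact (D (i + 1)) (D i)) (p : Ideal A) [p.IsPrime]
    (i : Fin s) :
    lengthAt p (({j // j ∈ c.S i} → A) ⧸ LinearMap.range (c.φ i).mulVecLin) =
      lengthAt p (c.Quot (i + 1)) + lengthAt p (c.Quot i) := by
  rw [c.range_φ, lengthAt_quot_map, c.ker_proj_comp hD i i.2, LinearMap.range_comp,
    lengthAt_quot_map]
  have : Subsingleton (({j // j ∈ c.S i} → A) ⧸ LinearMap.range (c.proj i)) := by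
    rw [Submodule.Quotient.subsingleton_iff]
    exact LinearMap.range_eq_top.2 (coords_surjective _ _)
  rw [lengthAt_eq_zero p (X := ({j // j ∈ c.S i} → A) ⧸ LinearMap.range (c.proj i)), add_zero,
    sup_comm (LinearMap.range (D i))]

variable [IsNoetherianRing A] [UniqueFactorizationMonoid A]

theorem associated_det_φ (hD : ∀ i, Function.Exact (D (i + 1)) (D i)) (P : IrrReps A) (i : Fin s) :
    Associated (c.φ i).det (content P (c.Quot i) * content P (c.Quot (i + 1))) := by
  rw [mul_comm]
  refine associated_content_mul P (c.det_ne_zero i) fun π => ?_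
  have : (Ideal.span {(π : A)}).IsPrime := inferInstanceAs (P.ideal π).IsPrime
  rw [← lengthAt_quot_range_mulVecLin (P.prime π) (c.φ i) (c.det_ne_zero i)]
  exact c.lengthAt_quot_φ hD (P.ideal π) i

/-- The Cayley determinant of a free resolution of `N` is the content of `N`. -/
theorem det_eq_content (hD : ∀ i, Function.Exact (D (i + 1)) (D i)) (P : IrrReps A) {N : Type*}
    [AddCommGroup N] [Module A N] (ε : C 0 →ₗ[A] N) (hε : Function.Surjective ε)
    (hexact : Function.Exact (D 0) ε) :
    ∃ u : Aˣ, c.det = algebraMap A (FractionRing A) (u * content P N) := by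
  obtain ⟨u, hu⟩ := prod_alternating_zpow (fun i => (c.φ i).det)
    (fun i => content P (c.Quot i)) (fun i => content_ne_zero P _) (c.associated_det_φ hD P)
  refine ⟨u, ?_⟩
  have hs : Subsingleton (c.Quot s) := by
    rw [Submodule.Quotient.subsingleton_iff, eq_top_iff]
    refine le_trans (fun x _ => ?_) le_sup_left
    rw [LinearMap.mem_ker]
    funext j
    have hj : ∀ j, j ∉ c.S s := fun j h => by
      rw [c.S_top] at h
      exact Finset.notMem_empty _ h
    exact absurd j.2 (hj _)
  have h0 : LinearMap.ker (c.proj 0) ⊔ LinearMap.range (D 0) = LinearMap.ker ε := by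
    rw [LinearMap.exact_iff.1 hexact, sup_eq_right]
    intro x hx
    have h := sum_eq_of_coords_eq_zero (c.basis 0) (c.S 0) (Equiv.refl _) hx
    rw [← h, Finset.sum_eq_zero fun b _ => absurd (c.mem_S_zero b.1) b.2]
    exact Submodule.zero_mem _
  have e : c.Quot 0 ≃ₗ[A] N :=
    (Submodule.quotEquivOfEq _ _ h0).trans (ε.quotKerEquivOfSurjective hε)
  rw [content_eq_one P (N := c.Quot s), map_one, one_zpow, mul_one, content_congr P e] at hu
  exact hu

end CayleyData

end CayleyDet

/-! ### Existence of admissible partitions, and generic exactness. -/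

section CayleyExistence

variable {A : Type*} [CommRing A] [IsDomain A]

/-- `T` spans a submodule of full rank if it spans the generators up to torsion. -/
theorem isTorsion_quot_span {Y ι : Type*} [AddCommGroup Y] [Module A Y] (v : ι → Y) (T : Set ι)
    (hT : ∀ i ∉ T, ∃ a : A, a ≠ 0 ∧ a • v i ∈ Submodule.span A (v '' T))
    (h : ∀ y : Y, ∃ a : A, a ≠ 0 ∧ a • y ∈ Submodule.span A (Set.range v)) (y : Y) :
    ∃ a : A, a ≠ 0 ∧ a • y ∈ Submodule.span A (v '' T) := by
  have hle : Submodule.span A (Set.range v) ≤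
      (Submodule.torsion A (Y ⧸ Submodule.span A (v '' T))).comap (Submodule.mkQ _) := by
    rw [Submodule.span_le]
    rintro _ ⟨i, rfl⟩
    rw [SetLike.mem_coe, Submodule.mem_comap, Submodule.mem_torsion_iff]
    by_cases hi : i ∈ T
    · refine ⟨1, ?_⟩
      rw [one_smul, Submodule.mkQ_apply, Submodule.Quotient.mk_eq_zero]
      exact Submodule.subset_span ⟨i, hi, rfl⟩
    · obtain ⟨a, ha, hai⟩ := hT i hi
      refine ⟨⟨a, mem_nonZeroDivisors_of_ne_zero ha⟩, ?_⟩
      rw [Submonoid.mk_smul, ← map_smul, Submodule.mkQ_apply, Submodule.Quotient.mk_eq_zero]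
      exact hai
  obtain ⟨a, ha, hay⟩ := h y
  obtain ⟨b, hb⟩ := (Submodule.mem_torsion_iff _).1 (hle hay)
  refine ⟨b * a, mul_ne_zero (nonZeroDivisors.ne_zero b.2) ha, ?_⟩
  rwa [mul_smul, ← Submodule.Quotient.mk_eq_zero, ← Submodule.mkQ_apply, map_smul]

theorem card_eq_finrank_of_linearIndependent {Y κ : Type*} [AddCommGroup Y] [Module A Y]
    [Fintype κ] {w : κ → Y} (hw : LinearIndependent A w)
    (h : ∀ y : Y, ∃ a : A, a ≠ 0 ∧ a • y ∈ Submodule.span A (Set.range w)) [Module.Finite A Y] :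
    Fintype.card κ = Module.finrank A Y := by
  have h0 : Module.finrank A (Y ⧸ Submodule.span A (Set.range w)) = 0 := by
    rw [Module.finrank_eq_zero_iff_isTorsion]
    intro y
    induction y using Submodule.Quotient.induction_on with | _ y
    obtain ⟨a, ha, hay⟩ := h y
    refine ⟨⟨a, mem_nonZeroDivisors_of_ne_zero ha⟩, ?_⟩
    rw [Submonoid.mk_smul, ← Submodule.Quotient.mk_smul, Submodule.Quotient.mk_eq_zero]
    exact hay
  rw [← Submodule.finrank_quotient_add_finrank (Submodule.span A (Set.range w)), h0,
    finrank_span_eq_card hw, zero_add]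

/-- The part `S` of the basis `b` projects the submodule `Z` isomorphically up to torsion. -/
def IsComplementary {X : Type*} [AddCommGroup X] [Module A X] {ι : Type*} [Finite ι]
    (b : Module.Basis ι A X) (Z : Submodule A X) (S : Finset ι) : Prop :=
  (∀ x ∈ Z, coords b S x = 0 → x = 0) ∧
    ∀ y : {j // j ∈ S} → A, ∃ a : A, a ≠ 0 ∧ a • y ∈ Z.map (coords b S)

/-- One step of the recursion. Among the images of the basis `b'` in the coordinates `S`, a maximal
independent family gives the columns of the block, and the remaining indices form `S'`. Modulo
torsion, the chosen columns span a complement of `ker g`, so `S'` is complementary to `ker g`, which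
exactness identifies with the next image. -/
theorem IsComplementary.exists_succ {X X' : Type*} [AddCommGroup X] [Module A X]
    [AddCommGroup X'] [Module A X'] {ι ι' : Type*} [Fintype ι] [Fintype ι'] [DecidableEq ι]
    {b : Module.Basis ι A X} (b' : Module.Basis ι' A X') (g : X' →ₗ[A] X) {S : Finset ι}
    (hS : IsComplementary b (LinearMap.range g) S) :
    ∃ S' : Finset ι', IsComplementary b' (LinearMap.ker g) S' ∧
      ∃ e : {j // j ∈ S} ≃ {j // j ∉ S'},
        (Matrix.of fun a k => b.repr (g (b' (e k).1)) a.1 :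
          Matrix {j // j ∈ S} {j // j ∈ S} A).det ≠ 0 := by
  classical
  let h : X' →ₗ[A] ({j // j ∈ S} → A) := coords b S ∘ₗ g
  let v : ι' → ({j // j ∈ S} → A) := fun j => h (b' j)
  obtain ⟨T, hTi, hTm⟩ := exists_maximal_linearIndepOn A v
  let S' : Finset ι' := Finset.univ.filter fun j => j ∉ T
  have hS'T : ∀ j, j ∉ S' ↔ j ∈ T := by simp [S']
  have hrange : Submodule.span A (Set.range v) = LinearMap.range h := by
    rw [LinearMap.range_eq_map, ← b'.span_eq, Submodule.map_span, ← Set.range_comp]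
    rfl
  have hW := isTorsion_quot_span v T hTm (fun y => by
    obtain ⟨a, ha, hay⟩ := hS.2 y
    refine ⟨a, ha, ?_⟩
    rw [hrange, LinearMap.range_comp]
    exact hay)
  have hker : Submodule.span A (v '' T) ≤ (LinearMap.ker (coords b' S')).map h := by
    rw [Submodule.span_le]
    rintro _ ⟨j, hj, rfl⟩
    refine ⟨b' j, ?_, rfl⟩
    funext k
    have : (k : ι') ≠ j := fun hkj => (hS'T j).2 hj (hkj ▸ k.2)
    simp [coords_apply, this.symm]
  -- The chosen columns are independent and of full rank in the free module on `S`, so the block is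
  -- square.
  have hcard : Fintype.card {j // j ∈ S} = Fintype.card {j // j ∉ S'} := by
    have := card_eq_finrank_of_linearIndependent hTi (fun y => by
      have := hW y
      rwa [Set.image_eq_range] at this)
    rw [Module.finrank_fintype_fun_eq_card] at this
    rw [← this]
    exact Fintype.card_congr (Equiv.subtypeEquivRight fun j => (hS'T j).symm)
  let e : {j // j ∈ S} ≃ {j // j ∉ S'} := Fintype.equivOfCardEq hcard
  have hli : ∀ w : {j // j ∈ S} → A, ∑ k, w k • v (e k) = 0 → w = 0 := by
    have := hTi.linearIndependent.comp (fun k => ⟨e k, (hS'T _).1 (e k).2⟩)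
      (fun k l hkl => e.injective (Subtype.ext (congrArg (fun x => x.1) hkl)))
    intro w hw
    exact funext (Fintype.linearIndependent_iff.1 this w hw)
  have hinj : ∀ x, coords b' S' x = 0 → h x = 0 → x = 0 := by
    intro x hx hhx
    have h1 := sum_eq_of_coords_eq_zero b' S' e hx
    rw [← h1, map_sum] at hhx
    simp only [map_smul] at hhx
    have h2 := hli (fun k => b'.repr x (e k)) hhx
    rw [← h1]
    exact Finset.sum_eq_zero fun k _ => by rw [congrFun h2 k, Pi.zero_apply, zero_smul]
  refine ⟨S', ⟨fun x hx hx' => hinj x hx' ?_, fun y => ?_⟩, e, ?_⟩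
  · rw [LinearMap.comp_apply, LinearMap.mem_ker.1 hx, map_zero]
  · obtain ⟨x, rfl⟩ := coords_surjective b' S' y
    obtain ⟨a, ha, hax⟩ := hW (h x)
    obtain ⟨w, hw, hwx⟩ := hker hax
    -- Subtracting `w`, which is invisible in the coordinates `S'`, corrects `a • x` to an element
    -- of `ker g`: its image lies in `range g` and has zero coordinates in `S`.
    refine ⟨a, ha, a • x - w, ?_, by rw [map_sub, LinearMap.mem_ker.1 hw, map_smul, sub_zero]⟩
    rw [SetLike.mem_coe, LinearMap.mem_ker]
    refine hS.1 _ ⟨_, rfl⟩ ?_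
    change h _ = 0
    rw [map_sub, hwx, map_smul, sub_self]
  · intro hdet
    obtain ⟨w, hw0, hw⟩ := Matrix.exists_mulVec_eq_zero_iff.2 hdet
    refine hw0 (hli w ?_)
    rw [← hw]
    funext a
    rw [Finset.sum_apply, Matrix.mulVec, dotProduct]
    exact Finset.sum_congr rfl fun k _ => mul_comm _ _

variable {C : ℕ → Type*} [∀ i, AddCommGroup (C i)]
  [∀ i, Module A (C i)] {D : ∀ i, C (i + 1) →ₗ[A] C i} {s : ℕ}

theorem CayleyData.nonempty [∀ i, Module.Free A (C i)] [∀ i, Module.Finite A (C i)]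
    (hD : ∀ i, Function.Exact (D (i + 1)) (D i))
    (h0 : ∀ x : C 0, ∃ a : A, a ≠ 0 ∧ a • x ∈ LinearMap.range (D 0))
    [Subsingleton (C (s + 1))] : Nonempty (CayleyData D s) := by
  classical
  let k : ℕ → ℕ := fun i => Module.finrank A (C i)
  let b : ∀ i, Module.Basis (Fin (k i)) A (C i) := fun i => Module.finBasis A (C i)
  have hstep : ∀ i (S : Finset (Fin (k i))),
      IsComplementary (b i) (LinearMap.range (D i)) S →
      ∃ S' : Finset (Fin (k (i + 1))),
        IsComplementary (b (i + 1)) (LinearMap.range (D (i + 1))) S' ∧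
        ∃ e : {j // j ∈ S} ≃ {j // j ∉ S'},
          (Matrix.of fun a l => (b i).repr (D i (b (i + 1) (e l).1)) a.1 :
            Matrix {j // j ∈ S} {j // j ∈ S} A).det ≠ 0 := by
    intro i S hS
    obtain ⟨S', hS', he⟩ := hS.exists_succ (b (i + 1)) (D i)
    rw [LinearMap.exact_iff.1 (hD i)] at hS'
    exact ⟨S', hS', he⟩
  have hzero : IsComplementary (b 0) (LinearMap.range (D 0)) Finset.univ := by
    refine ⟨fun x _ hx => ?_, fun y => ?_⟩
    · rw [← sum_eq_of_coords_eq_zero (b 0) Finset.univ (Equiv.refl _) hx]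
      exact Finset.sum_eq_zero fun j _ => absurd (Finset.mem_univ _) j.2
    · obtain ⟨x, rfl⟩ := coords_surjective (b 0) Finset.univ y
      obtain ⟨a, ha, hax⟩ := h0 x
      exact ⟨a, ha, a • x, hax, map_smul _ _ _⟩
  choose next hnext enext hdet using hstep
  let S : ∀ i, {S : Finset (Fin (k i)) // IsComplementary (b i) (LinearMap.range (D i)) S} :=
    fun i => Nat.rec ⟨Finset.univ, hzero⟩ (fun i S => ⟨next i S.1 S.2, hnext i S.1 S.2⟩) i
  refine ⟨{
    k := k
    basis := b
    S := fun i => (S i).1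
    S_zero := rfl
    S_top := ?_
    e := fun i => enext i (S i).1 (S i).2
    φ := fun i => Matrix.of fun a l =>
      (b i).repr (D i (b (i + 1) (enext i (S i).1 (S i).2 l).1)) a.1
    φ_eq := fun i a l => rfl
    det_ne_zero := fun i => hdet i (S i).1 (S i).2 }⟩
  rw [Finset.eq_empty_iff_forall_notMem]
  intro j hj
  -- Since `C (s + 1) = 0`, the image of `D s` is zero. It has full rank in the coordinates `S s`
  -- only if there are none; the all-ones vector detects this.
  obtain ⟨a, ha, x, ⟨y, hy⟩, hx⟩ := (S s).2.2 1
  rw [Subsingleton.elim y 0, map_zero] at hy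
  rw [← hy, map_zero] at hx
  have := congrFun hx ⟨j, hj⟩
  simp at this
  exact ha this.symm

/-- Flatness of the fraction field preserves exactness in positive degrees; in degree zero the
torsion cokernel dies. -/
theorem isGenericallyExact_of_exact (hD : ∀ i, Function.Exact (D (i + 1)) (D i))
    (h0 : ∀ x : C 0, ∃ a : A, a ≠ 0 ∧ a • x ∈ LinearMap.range (D 0)) :
    IsGenericallyExact D := by
  refine ⟨fun z => ?_, fun i => Module.Flat.lTensor_exact (FractionRing A) (hD i)⟩
  induction z using TensorProduct.induction_on with
  | zero => exact ⟨0, map_zero _⟩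
  | add z z' hz hz' =>
    obtain ⟨w, rfl⟩ := hz
    obtain ⟨w', rfl⟩ := hz'
    exact ⟨w + w', map_add _ _ _⟩
  | tmul c x =>
    obtain ⟨a, ha, y, hy⟩ := h0 x
    have ha' : algebraMap A (FractionRing A) a ≠ 0 := by
      rwa [ne_eq, IsFractionRing.to_map_eq_zero_iff]
    refine ⟨((algebraMap A (FractionRing A) a)⁻¹ * c) ⊗ₜ[A] y, ?_⟩
    rw [LinearMap.baseChange_tmul, hy, TensorProduct.tmul_smul, TensorProduct.smul_tmul',
      Algebra.smul_def, mul_inv_cancel_left₀ ha']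

end CayleyExistence

/-! ### Shifted components and large multidegrees. -/

section Shift

variable {A : Type*} [CommRing A] {q : ℕ} {M : Type*} [AddCommGroup M] [Module A M]
  {ℳ : (Fin q → ℕ) → Submodule A M}

theorem shiftGrading_of_le {d ν : Fin q → ℕ} (h : d ≤ ν) : shiftGrading ℳ d ν = ℳ (ν - d) := by
  simp [shiftGrading, h]

theorem shiftGrading_of_not_le {d ν : Fin q → ℕ} (h : ¬ d ≤ ν) : shiftGrading ℳ d ν = ⊥ := by
  simp [shiftGrading, h]

theorem shiftGrading_zero (ν : Fin q → ℕ) : shiftGrading ℳ 0 ν = ℳ ν := by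
  rw [shiftGrading_of_le (zero_le : 0 ≤ ν), tsub_zero]

theorem shiftGrading_add {c d ν : Fin q → ℕ} (hc : c ≤ ν) :
    shiftGrading ℳ (c + d) ν = shiftGrading ℳ d (ν - c) := by
  by_cases h : c + d ≤ ν
  · rw [shiftGrading_of_le h, shiftGrading_of_le (le_tsub_of_add_le_left h), tsub_tsub]
  · rw [shiftGrading_of_not_le h, shiftGrading_of_not_le]
    exact fun h' => h (by rw [add_comm]; exact (le_tsub_iff_right hc).1 h')

theorem eventually_tsub {p : (Fin q → ℕ) → Prop} (h : ∀ᶠ ν in Filter.atTop, p ν)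
    (d : Fin q → ℕ) : ∀ᶠ ν in Filter.atTop, d ≤ ν ∧ p (ν - d) := by
  obtain ⟨ν₀, hν₀⟩ := Filter.eventually_atTop.1 h
  exact Filter.eventually_atTop.2 ⟨ν₀ + d, fun ν hν =>
    ⟨le_trans le_add_self hν, hν₀ _ (le_tsub_of_add_le_right hν)⟩⟩

end Shift

/-! ### Homogeneous representations of elements of `(f_0, …, f_{t-1}) M`. -/

section PartialIdeal

variable {A : Type*} [CommRing A] {q : ℕ} {R : Type*} [CommRing R] [Algebra A R]
  {M : Type*} [AddCommGroup M] [Module A M] [Module R M] {s : ℕ}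

/-- The submodule `(f_0, …, f_{t-1}) M`. -/
def partialSubmodule (f : Fin s → R) (M : Type*) [AddCommGroup M] [Module R M] (t : ℕ) :
    Submodule R M :=
  Ideal.span (f '' {j | (j : ℕ) < t}) • ⊤

theorem smul_mem_partialSubmodule (f : Fin s → R) {t : ℕ} {j : Fin s} (hj : (j : ℕ) < t) (m : M) :
    f j • m ∈ partialSubmodule f M t :=
  Submodule.smul_mem_smul (Ideal.subset_span ⟨j, hj, rfl⟩) trivial

theorem exists_of_mem_partialSubmodule (f : Fin s → R) {t : ℕ} {x : M}
    (hx : x ∈ partialSubmodule f M t) :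
    ∃ y : Fin s → M, (∀ j : Fin s, t ≤ j → y j = 0) ∧ ∑ j, f j • y j = x := by
  let P : Submodule R M :=
    { carrier := {x | ∃ y : Fin s → M, (∀ j : Fin s, t ≤ j → y j = 0) ∧ ∑ j, f j • y j = x}
      zero_mem' := ⟨0, fun _ _ => rfl, by simp⟩
      add_mem' := by
        rintro _ _ ⟨y, hy, rfl⟩ ⟨z, hz, rfl⟩
        exact ⟨y + z, fun j hj => by simp [hy j hj, hz j hj], by
          simp [Finset.sum_add_distrib]⟩
      smul_mem' := by
        rintro a _ ⟨y, hy, rfl⟩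
        refine ⟨a • y, fun j hj => by simp [hy j hj], ?_⟩
        rw [Finset.smul_sum]
        exact Finset.sum_congr rfl fun j _ => smul_comm _ _ _ }
  suffices h : partialSubmodule f M t ≤ P from h hx
  refine Submodule.smul_le.2 fun a ha m _ => ?_
  induction ha using Submodule.span_induction with
  | mem a ha =>
    obtain ⟨j, hj, rfl⟩ := ha
    refine ⟨Pi.single j m, fun i hi => ?_, ?_⟩
    · have hj' : (j : ℕ) < t := hj
      exact Pi.single_eq_of_ne (fun h => by subst h; omega) _
    · rw [Finset.sum_eq_single j (fun i _ hi => by rw [Pi.single_eq_of_ne hi, smul_zero])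
        (by simp), Pi.single_eq_same]
  | zero => rw [zero_smul]; exact P.zero_mem
  | add a b _ _ ha hb => rw [add_smul]; exact P.add_mem ha hb
  | smul a b _ hb => rw [smul_eq_mul, mul_smul]; exact P.smul_mem a hb

variable {𝒜 : (Fin q → ℕ) → Submodule A R} {ℳ : (Fin q → ℕ) → Submodule A M}
  [SetLike.GradedSMul 𝒜 ℳ] [DirectSum.Decomposition ℳ]

theorem exists_decompose_smul_eq {a : R} {d : Fin q → ℕ} (ha : a ∈ 𝒜 d) (μ : Fin q → ℕ) (z : M) :
    ∃ y ∈ shiftGrading ℳ d μ, (DirectSum.decompose ℳ (a • z) μ : M) = a • y := by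
  induction z using DirectSum.Decomposition.inductionOn ℳ with
  | zero => exact ⟨0, Submodule.zero_mem _, by simp⟩
  | @homogeneous ν z =>
    have hz : a • (z : M) ∈ ℳ (d + ν) := SetLike.GradedSMul.smul_mem ha z.2
    by_cases h : d + ν = μ
    · subst h
      refine ⟨z, ?_, DirectSum.decompose_of_mem_same ℳ hz⟩
      rw [shiftGrading_of_le le_self_add, add_tsub_cancel_left]
      exact z.2
    · exact ⟨0, Submodule.zero_mem _, by
        rw [DirectSum.decompose_of_mem_ne ℳ hz h, smul_zero]⟩
  | add z z' hz hz' =>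
    obtain ⟨y, hy, h⟩ := hz
    obtain ⟨y', hy', h'⟩ := hz'
    refine ⟨y + y', Submodule.add_mem _ hy hy', ?_⟩
    rw [smul_add, DirectSum.decompose_add, DirectSum.add_apply, Submodule.coe_add, h, h', smul_add]

/-- Taking the component of multidegree `μ` in any representation of `x` makes the coefficients
homogeneous. The coefficients with index at least `t` are reset to zero, since
`exists_decompose_smul_eq` does not guarantee that it returns zero there. -/
theorem exists_homogeneous_of_mem_partialSubmodule {f : Fin s → R} {d : Fin s → Fin q → ℕ}
    (hf : ∀ i, f i ∈ 𝒜 (d i)) {t : ℕ} {μ : Fin q → ℕ} {x : M} (hxμ : x ∈ ℳ μ)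
    (hx : x ∈ partialSubmodule f M t) :
    ∃ y : Fin s → M, (∀ j, y j ∈ shiftGrading ℳ (d j) μ) ∧ (∀ j : Fin s, t ≤ j → y j = 0) ∧
      ∑ j, f j • y j = x := by
  obtain ⟨z, hz, rfl⟩ := exists_of_mem_partialSubmodule f hx
  choose y hy hyz using fun j => exists_decompose_smul_eq (ℳ := ℳ) (hf j) μ (z j)
  refine ⟨fun j => if t ≤ j then 0 else y j, fun j => ?_, fun j hj => if_pos hj, ?_⟩
  · dsimp only
    split_ifs
    · exact Submodule.zero_mem _
    · exact hy j
  · rw [← DirectSum.decompose_of_mem_same ℳ hxμ, DirectSum.decompose_sum, DFinsupp.finsetSum_apply,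
      AddSubmonoidClass.coe_finsetSum]
    refine Finset.sum_congr rfl fun j _ => ?_
    dsimp only
    split_ifs with h
    · simp [hz j h]
    · exact (hyz j).symm

end PartialIdeal

/-! ### The Koszul complex on all subsets at once; contraction and multiplication by the last
generator. -/

section Total

variable {R : Type*} [CommRing R] {M : Type*} [AddCommGroup M] [Module R M] {s : ℕ}

/-- The Koszul differential on the sum of all the `K_p(f, M)`. -/
def totalD (f : Fin s → R) : (Finset (Fin s) → M) →ₗ[R] (Finset (Fin s) → M) where
  toFun m J := ∑ i, if i ∈ J then 0 else (koszulSign R J i * f i) • m (insert i J)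
  map_add' m m' := by
    ext J
    simp only [Pi.add_apply, ← Finset.sum_add_distrib]
    exact Finset.sum_congr rfl fun i _ => by split_ifs <;> simp
  map_smul' a m := by
    ext J
    simp only [Pi.smul_apply, RingHom.id_apply, Finset.smul_sum]
    exact Finset.sum_congr rfl fun i _ => by
      split_ifs
      · simp
      · exact smul_comm _ _ _

theorem totalD_apply (f : Fin s → R) (m : Finset (Fin s) → M) (J : Finset (Fin s)) :
    totalD f m J = ∑ i, if i ∈ J then 0 else (koszulSign R J i * f i) • m (insert i J) := rfl

theorem totalD_empty (f : Fin s → R) (m : Finset (Fin s) → M) :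
    totalD f m ∅ = ∑ i, f i • m {i} := by
  simp [totalD_apply, koszulSign]

theorem totalD_eq_koszulD (f : Fin s → R) (m : Finset (Fin s) → M) {p : ℕ} (J : Sub s p) :
    totalD f m J.1 = koszulD f M p (fun I => m I.1) J := by
  rw [totalD_apply]
  change _ = ∑ i : {i : Fin s // i ∉ J.1}, (koszulSign R J.1 i.1 * f i.1) • m (insert i.1 J.1)
  rw [← Finset.sum_subtype (Finset.univ.filter fun i => i ∉ J.1) (by simp)
    (fun i => (koszulSign R J.1 i * f i) • m (insert i J.1)), Finset.sum_filter]
  exact Finset.sum_congr rfl fun i _ => by split_ifs <;> rfl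

theorem totalD_totalD (f : Fin s → R) (m : Finset (Fin s) → M) : totalD f (totalD f m) = 0 := by
  funext J
  rw [totalD_eq_koszulD f (totalD f m) (⟨J, rfl⟩ : Sub s J.card)]
  have : (fun I : Sub s (J.card + 1) => totalD f m I.1) =
      koszulD f M (J.card + 1) (fun I => m I.1) := funext fun I => totalD_eq_koszulD f m I
  rw [this]
  exact congrFun (LinearMap.congr_fun (koszulD_comp (M := M) f J.card) fun I => m I.1) ⟨J, rfl⟩

theorem koszulSign_insert_of_lt {J : Finset (Fin s)} {i k : Fin s} (h : i < k) :
    koszulSign R (insert k J) i = koszulSign R J i := by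
  rw [koszulSign, koszulSign, Finset.filter_insert, if_neg h.le.not_gt]

variable {A : Type*} [CommRing A] [Algebra A R] [Module A M] {q : ℕ}
  {𝒜 : (Fin q → ℕ) → Submodule A R} {ℳ : (Fin q → ℕ) → Submodule A M}

/-- The component of multidegree `ν` of the sum of all the `K_p(f, M)`. -/
def totalSlice (ℳ : (Fin q → ℕ) → Submodule A M) (d : Fin s → Fin q → ℕ) (ν : Fin q → ℕ) :
    Submodule A (Finset (Fin s) → M) :=
  Submodule.pi Set.univ fun J => shiftGrading ℳ (∑ i ∈ J, d i) ν

theorem mem_totalSlice {d : Fin s → Fin q → ℕ} {ν : Fin q → ℕ} {m : Finset (Fin s) → M} :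
    m ∈ totalSlice ℳ d ν ↔ ∀ J, m J ∈ shiftGrading ℳ (∑ i ∈ J, d i) ν := by
  simp [totalSlice]

theorem totalD_mem_totalSlice [SetLike.GradedSMul 𝒜 ℳ] {f : Fin s → R}
    {d : Fin s → Fin q → ℕ} (hf : ∀ i, f i ∈ 𝒜 (d i)) {ν : Fin q → ℕ} {m : Finset (Fin s) → M}
    (hm : m ∈ totalSlice ℳ d ν) : totalD f m ∈ totalSlice ℳ d ν := by
  rw [mem_totalSlice] at hm ⊢
  intro J
  rw [totalD_apply]
  refine Submodule.sum_mem _ fun i _ => ?_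
  split_ifs with hi
  · exact Submodule.zero_mem _
  · have h1 := hm (insert i J)
    rw [Finset.sum_insert hi] at h1
    have h3 := smul_mem_shiftGrading (hf i) h1
    rw [mul_smul]
    rcases neg_one_pow_eq_or R (J.filter (· < i)).card with h | h
    · simpa [koszulSign, h] using h3
    · simpa [koszulSign, h] using h3

/-- `m` has no component at subsets containing an element `≥ t`. -/
def SupportedBelow (t : ℕ) (m : Finset (Fin s) → M) : Prop :=
  ∀ J : Finset (Fin s), ∀ j ∈ J, t ≤ (j : ℕ) → m J = 0

omit [Module R M] in
theorem SupportedBelow.add {t : ℕ} {m m' : Finset (Fin s) → M} (hm : SupportedBelow t m)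
    (hm' : SupportedBelow t m') : SupportedBelow t (m + m') := fun J j hj hjt => by
  rw [Pi.add_apply, hm J j hj hjt, hm' J j hj hjt, add_zero]

theorem SupportedBelow.totalD {t : ℕ} {m : Finset (Fin s) → M} (hm : SupportedBelow t m)
    (f : Fin s → R) : SupportedBelow t (totalD f m) := fun J j hj hjt => by
  rw [totalD_apply]
  refine Finset.sum_eq_zero fun i _ => ?_
  rw [hm (insert i J) j (Finset.mem_insert_of_mem hj) hjt, smul_zero, ite_self]

/-- The element of `K_1(f, M)` with coordinates `y`. -/
def ofSingletons (y : Fin s → M) (J : Finset (Fin s)) : M :=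
  ∑ j, if J = {j} then y j else 0

omit [Module R M] in
theorem ofSingletons_singleton (y : Fin s → M) (j : Fin s) : ofSingletons y {j} = y j := by
  simp [ofSingletons]

omit [Module R M] in
theorem ofSingletons_of_card_ne (y : Fin s → M) {J : Finset (Fin s)} (hJ : J.card ≠ 1) :
    ofSingletons y J = 0 :=
  Finset.sum_eq_zero fun j _ => if_neg fun h => hJ (by rw [h, Finset.card_singleton])

theorem totalD_ofSingletons (f : Fin s → R) (y : Fin s → M) (J : Finset (Fin s)) :
    totalD f (ofSingletons y) J = if J = ∅ then ∑ j, f j • y j else 0 := by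
  split_ifs with h
  · rw [h, totalD_empty]
    simp only [ofSingletons_singleton]
  · rw [totalD_apply]
    refine Finset.sum_eq_zero fun i _ => ?_
    split_ifs with hi
    · rfl
    · rw [ofSingletons_of_card_ne, smul_zero]
      rw [Finset.card_insert_of_notMem hi]
      have := Finset.card_ne_zero.2 (Finset.nonempty_iff_ne_empty.2 h)
      omega

theorem ofSingletons_mem_totalSlice {d : Fin s → Fin q → ℕ} {ν : Fin q → ℕ} {y : Fin s → M}
    (hy : ∀ j, y j ∈ shiftGrading ℳ (d j) ν) : ofSingletons y ∈ totalSlice ℳ d ν := by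
  rw [mem_totalSlice]
  intro J
  refine Submodule.sum_mem _ fun j _ => ?_
  split_ifs with h
  · subst h
    rw [Finset.sum_singleton]
    exact hy j
  · exact Submodule.zero_mem _

omit [Module R M] in
theorem supportedBelow_ofSingletons {t : ℕ} {y : Fin s → M} (hy : ∀ j : Fin s, t ≤ j → y j = 0) :
    SupportedBelow t (ofSingletons y) := fun J j hj hjt => by
  refine Finset.sum_eq_zero fun i _ => ?_
  split_ifs with h
  · subst h
    rw [Finset.mem_singleton] at hj
    exact hy i (hj ▸ hjt)
  · rfl

/-- The part of `m` divisible by `e_τ`, divided by `e_τ`. -/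
def contract (τ : Fin s) (m : Finset (Fin s) → M) (J : Finset (Fin s)) : M :=
  if τ ∈ J then 0 else m (insert τ J)

/-- Multiplication by `e_τ`. -/
def wedge (τ : Fin s) (m : Finset (Fin s) → M) (J : Finset (Fin s)) : M :=
  if τ ∈ J then m (J.erase τ) else 0

omit [Module R M] in
theorem supportedBelow_contract {τ : Fin s} {m : Finset (Fin s) → M}
    (hm : SupportedBelow (τ + 1) m) : SupportedBelow τ (contract τ m) := fun J j hj hjt => by
  unfold contract
  split_ifs with h
  · rfl
  · have hne : j ≠ τ := fun h' => h (h' ▸ hj)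
    exact hm _ j (Finset.mem_insert_of_mem hj)
      (Nat.succ_le_of_lt (lt_of_le_of_ne hjt fun h' => hne (Fin.ext h'.symm)))

omit [Module R M] in
theorem supportedBelow_wedge {τ : Fin s} {m : Finset (Fin s) → M}
    (hm : SupportedBelow τ m) : SupportedBelow (τ + 1) (wedge τ m) := fun J j hj hjt => by
  unfold wedge
  split_ifs with h
  · have hne : j ≠ τ := fun h' => by rw [h'] at hjt; omega
    exact hm _ j (Finset.mem_erase.2 ⟨hne, hj⟩) (by omega)
  · rfl

theorem contract_mem_totalSlice {d : Fin s → Fin q → ℕ} {ν : Fin q → ℕ} {τ : Fin s}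
    (hτ : d τ ≤ ν) {m : Finset (Fin s) → M} (hm : m ∈ totalSlice ℳ d ν) :
    contract τ m ∈ totalSlice ℳ d (ν - d τ) := by
  rw [mem_totalSlice] at hm ⊢
  intro J
  unfold contract
  split_ifs with h
  · exact Submodule.zero_mem _
  · rw [← shiftGrading_add hτ, ← Finset.sum_insert h]
    exact hm _

theorem wedge_mem_totalSlice {d : Fin s → Fin q → ℕ} {ν : Fin q → ℕ} {τ : Fin s}
    (hτ : d τ ≤ ν) {m : Finset (Fin s) → M} (hm : m ∈ totalSlice ℳ d (ν - d τ)) :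
    wedge τ m ∈ totalSlice ℳ d ν := by
  rw [mem_totalSlice] at hm ⊢
  intro J
  unfold wedge
  split_ifs with h
  · rw [← Finset.add_sum_erase _ _ h, shiftGrading_add hτ]
    exact hm _
  · exact Submodule.zero_mem _

/-- No sign appears because `τ` is the largest index involved: the Koszul sign counts smaller
elements only, so inserting `τ` does not affect the terms with `i < τ`, and those with `i > τ`
vanish. -/
theorem totalD_contract (f : Fin s → R) {τ : Fin s} {m : Finset (Fin s) → M}
    (hm : SupportedBelow (τ + 1) m) : totalD f (contract τ m) = contract τ (totalD f m) := by
  funext J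
  by_cases hJ : τ ∈ J
  · rw [contract, if_pos hJ, totalD_apply]
    refine Finset.sum_eq_zero fun i _ => ?_
    rw [contract, if_pos (Finset.mem_insert_of_mem hJ), smul_zero, ite_self]
  · rw [contract, if_neg hJ, totalD_apply, totalD_apply]
    refine Finset.sum_congr rfl fun i _ => ?_
    rcases eq_or_ne i τ with rfl | hi
    · rw [if_neg hJ, if_pos (Finset.mem_insert_self _ _), contract,
        if_pos (Finset.mem_insert_self _ _), smul_zero]
    · have h1 : i ∈ insert τ J ↔ i ∈ J := by simp [hi]
      simp only [h1]
      split_ifs with hiJ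
      · rfl
      · have h2 : τ ∉ insert i J := by simp [hi.symm, hJ]
        rw [contract, if_neg h2, Finset.insert_comm]
        rcases lt_or_gt_of_ne hi with h | h
        · rw [koszulSign_insert_of_lt h]
        · rw [hm (insert i (insert τ J)) i (Finset.mem_insert_self _ _) (Nat.succ_le_of_lt h),
            smul_zero, smul_zero]

/-- Only subsets containing `τ` are considered. On the others the differential also produces terms
with `f τ`, which need no formula: they are absorbed by the induction over fewer elements. -/
theorem totalD_wedge (f : Fin s → R) {τ : Fin s} {m : Finset (Fin s) → M}
    (hm : SupportedBelow τ m) {J : Finset (Fin s)} (hJ : τ ∈ J) :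
    totalD f (wedge τ m) J = totalD f m (J.erase τ) := by
  rw [totalD_apply, totalD_apply]
  refine Finset.sum_congr rfl fun i _ => ?_
  rcases eq_or_ne i τ with rfl | hi
  · rw [if_pos hJ, if_neg (Finset.notMem_erase _ _),
      hm _ i (Finset.mem_insert_self _ _) le_rfl, smul_zero]
  · have h1 : i ∈ J.erase τ ↔ i ∈ J := by simp [hi]
    simp only [h1]
    split_ifs with hiJ
    · rfl
    · rw [wedge, if_pos (Finset.mem_insert_of_mem hJ), Finset.erase_insert_of_ne hi]
      rcases lt_or_gt_of_ne hi with h | h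
      · conv_lhs => rw [← Finset.insert_erase hJ, koszulSign_insert_of_lt h]
        rw [Finset.insert_erase hJ]
      · rw [hm (insert i (J.erase τ)) i (Finset.mem_insert_self _ _) (le_of_lt h),
          smul_zero, smul_zero]

end Total

/-! ### Acyclicity for filter-regular sequences. -/

section Acyclic

variable {A : Type*} [CommRing A] {q : ℕ} {R : Type*} [CommRing R] [Algebra A R]
  {M : Type*} [AddCommGroup M] [Module A M] [Module R M] [IsScalarTower A R M] {s : ℕ}
  {𝒜 : (Fin q → ℕ) → Submodule A R}
  {ℳ : (Fin q → ℕ) → Submodule A M}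

theorem IsFilterRegularSeq.eventually_mem {f : Fin s → R} (hreg : IsFilterRegularSeq ℳ f)
    (i : Fin s) : ∀ᶠ ν in Filter.atTop, ∀ x ∈ ℳ ν, f i • x ∈ partialSubmodule f M i →
      x ∈ partialSubmodule f M i := by
  filter_upwards [hreg i] with ν hν x hx hfx
  have := hν (Submodule.Quotient.mk x) ⟨x, hx, rfl⟩ (by
    rw [← Submodule.Quotient.mk_smul, Submodule.Quotient.mk_eq_zero]
    exact hfx)
  rwa [Submodule.Quotient.mk_eq_zero] at this

variable [SetLike.GradedSMul 𝒜 ℳ] [DirectSum.Decomposition ℳ]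

/-- The Koszul complex of a filter-regular sequence is acyclic in large multidegrees. -/
theorem eventually_exists_totalD_eq {f : Fin s → R} {d : Fin s → Fin q → ℕ}
    (hf : ∀ i, f i ∈ 𝒜 (d i)) (hreg : IsFilterRegularSeq ℳ f) (t : ℕ) (ht : t ≤ s) :
    ∀ᶠ ν in Filter.atTop, ∀ m ∈ totalSlice ℳ d ν, SupportedBelow t m → m ∅ = 0 →
      totalD f m = 0 →
      ∃ w ∈ totalSlice ℳ d ν, SupportedBelow t w ∧ w ∅ = 0 ∧ totalD f w = m := by
  induction t with
  | zero =>
    refine Filter.Eventually.of_forall fun ν m _ hs h0 _ =>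
      ⟨0, Submodule.zero_mem _, fun _ _ _ _ => rfl, rfl, ?_⟩
    rw [map_zero]
    funext J
    rcases J.eq_empty_or_nonempty with rfl | ⟨j, hj⟩
    · exact h0.symm
    · exact (hs J j hj (Nat.zero_le _)).symm
  | succ t ih =>
    let τ : Fin s := ⟨t, ht⟩
    -- The induction hypothesis is used twice: at `ν` for the part of the cycle without `e_τ`, and
    -- at `ν - d τ` for the coefficient of `e_τ`. Regularity of `f τ` is also needed at `ν - d τ`.
    filter_upwards [ih (by omega), eventually_tsub (ih (by omega)) (d τ),
      eventually_tsub (hreg.eventually_mem τ) (d τ)]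
      with ν hν ⟨hdν, hντ⟩ ⟨_, hregν⟩ m hm hsupp h0 hDm
    have hc := contract_mem_totalSlice hdν hm
    have hcs : SupportedBelow t (contract τ m) := supportedBelow_contract (τ := τ) hsupp
    have hcD : totalD f (contract τ m) = 0 := by
      rw [totalD_contract f hsupp, hDm]
      funext J
      simp [contract]
    have hc0 : contract τ m ∅ = m {τ} := by simp [contract]
    have hmτ : m {τ} ∈ ℳ (ν - d τ) := by
      have := mem_totalSlice.1 hc ∅
      rwa [hc0, Finset.sum_empty, shiftGrading_zero] at this
    -- The coordinate of `D m = 0` at `∅` reads `f_τ m_τ = -∑ f_j m_j` over `j < t`, which is where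
    -- filter-regularity enters.
    have hmI : m {τ} ∈ partialSubmodule f M t := by
      refine hregν _ hmτ ?_
      have h1 : totalD f m ∅ = 0 := by rw [hDm]; rfl
      rw [totalD_empty, ← Finset.add_sum_erase _ _ (Finset.mem_univ τ)] at h1
      rw [eq_neg_of_add_eq_zero_left h1]
      refine Submodule.neg_mem _ (Submodule.sum_mem _ fun j hj => ?_)
      rcases lt_or_ge (j : ℕ) t with h | h
      · exact smul_mem_partialSubmodule f h _
      · have hne : j ≠ τ := (Finset.mem_erase.1 hj).1
        have hlt : t + 1 ≤ (j : ℕ) :=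
          Nat.succ_le_of_lt (lt_of_le_of_ne h fun h' => hne (Fin.ext h'.symm))
        rw [hsupp {j} j (Finset.mem_singleton_self j) hlt, smul_zero]
        exact Submodule.zero_mem _
    obtain ⟨y, hyν, hyt, hy⟩ := exists_homogeneous_of_mem_partialSubmodule hf hmτ hmI
    -- The contracted cycle can have a nonzero coordinate at `∅`, which the induction hypothesis
    -- does not allow. That coordinate is `∑ f_j y_j`, so subtracting the boundary of `y` removes
    -- it.
    have hm₁ : contract τ m - totalD f (ofSingletons y) ∈ totalSlice ℳ d (ν - d τ) :=
      Submodule.sub_mem _ hc (totalD_mem_totalSlice hf (ofSingletons_mem_totalSlice hyν))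
    have hs₁ : SupportedBelow t (contract τ m - totalD f (ofSingletons y)) :=
      fun J j hj hjt => by
        rw [Pi.sub_apply, hcs J j hj hjt,
          (supportedBelow_ofSingletons hyt).totalD f J j hj hjt, sub_zero]
    obtain ⟨w₁, hw₁, hw₁s, hw₁0, hw₁D⟩ := hντ _ hm₁ hs₁
      (by rw [Pi.sub_apply, hc0, totalD_ofSingletons, if_pos rfl, hy, sub_self])
      (by rw [map_sub, hcD, totalD_totalD, sub_zero])
    let w := ofSingletons y + w₁
    have hw : w ∈ totalSlice ℳ d (ν - d τ) :=
      Submodule.add_mem _ (ofSingletons_mem_totalSlice hyν) hw₁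
    have hws : SupportedBelow t w := (supportedBelow_ofSingletons hyt).add hw₁s
    have hw0 : w ∅ = 0 := by
      change ofSingletons y ∅ + w₁ ∅ = 0
      rw [hw₁0, ofSingletons_of_card_ne _ (by simp), add_zero]
    have hwD : totalD f w = contract τ m := by
      rw [map_add, hw₁D, add_sub_cancel]
    have hW : wedge τ w ∈ totalSlice ℳ d ν := wedge_mem_totalSlice hdν hw
    have hWs : SupportedBelow (t + 1) (wedge τ w) := supportedBelow_wedge (τ := τ) hws
    have hW0 : wedge τ w ∅ = 0 := by simp [wedge]
    -- The boundary of `wedge τ w` has the same `e_τ` part as `m`, so the difference is a cycle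
    -- involving only `f_0, …, f_{t-1}`.
    have hm₂s : SupportedBelow t (m - totalD f (wedge τ w)) := fun J j hj hjt => by
      rcases eq_or_ne j τ with rfl | hne
      · rw [Pi.sub_apply, totalD_wedge f hws hj, hwD, contract,
          if_neg (Finset.notMem_erase _ _), Finset.insert_erase hj, sub_self]
      · have hlt : t + 1 ≤ (j : ℕ) :=
          Nat.succ_le_of_lt (lt_of_le_of_ne hjt fun h' => hne (Fin.ext h'.symm))
        rw [Pi.sub_apply, hsupp J j hj hlt, hWs.totalD f J j hj hlt, sub_zero]
    have hm₂0 : (m - totalD f (wedge τ w)) ∅ = 0 := by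
      rw [Pi.sub_apply, h0, totalD_empty, zero_sub, neg_eq_zero]
      refine Finset.sum_eq_zero fun j _ => ?_
      unfold wedge
      split_ifs with h
      · rw [Finset.mem_singleton] at h
        rw [h, Finset.erase_singleton, hw0, smul_zero]
      · rw [smul_zero]
    obtain ⟨w₂, hw₂, hw₂s, hw₂0, hw₂D⟩ := hν _
      (Submodule.sub_mem _ hm (totalD_mem_totalSlice hf hW)) hm₂s hm₂0
      (by rw [map_sub, hDm, totalD_totalD, sub_zero])
    refine ⟨w₂ + wedge τ w, Submodule.add_mem _ hw₂ hW,
      SupportedBelow.add (fun J j hj hjt => hw₂s J j hj (by omega)) hWs, ?_, ?_⟩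
    · rw [Pi.add_apply, hw₂0, hW0, add_zero]
    · rw [map_add, hw₂D, sub_add_cancel]

end Acyclic

/-! ### Slices as finite free modules. -/

section SliceComponents

variable {A : Type*} [CommRing A] {q : ℕ} {M : Type*} [AddCommGroup M] [Module A M] {s : ℕ}
  {ℳ : (Fin q → ℕ) → Submodule A M}

theorem mem_koszulSlice {d : Fin s → Fin q → ℕ} {ν : Fin q → ℕ} {p : ℕ}
    {m : KoszulModule s M p} : m ∈ koszulSlice ℳ d ν p ↔
      ∀ J, m J ∈ shiftGrading ℳ (∑ i ∈ J.1, d i) ν := by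
  simp [koszulSlice]

theorem restrict_mem_koszulSlice {d : Fin s → Fin q → ℕ} {ν : Fin q → ℕ}
    {m : Finset (Fin s) → M} (hm : m ∈ totalSlice ℳ d ν) (p : ℕ) :
    (fun I : Sub s p => m I.1) ∈ koszulSlice ℳ d ν p :=
  mem_koszulSlice.2 fun J => mem_totalSlice.1 hm J.1

/-- The empty subset. -/
def Sub.empty (s : ℕ) : Sub s 0 := ⟨∅, rfl⟩

theorem Sub.eq_empty (J : Sub s 0) : J = Sub.empty s := Subtype.ext (Finset.card_eq_zero.1 J.2)

theorem koszulSlice_zero_apply_mem {d : Fin s → Fin q → ℕ} {ν : Fin q → ℕ}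
    (x : koszulSlice ℳ d ν 0) : x.1 (Sub.empty s) ∈ ℳ ν := by
  have := mem_koszulSlice.1 x.2 (Sub.empty s)
  rwa [Sub.empty, Finset.sum_empty, shiftGrading_zero] at this

/-- A slice of the Koszul complex is a product of components of `M`. -/
def koszulSliceEquiv (ℳ : (Fin q → ℕ) → Submodule A M) (d : Fin s → Fin q → ℕ) (ν : Fin q → ℕ)
    (p : ℕ) : koszulSlice ℳ d ν p ≃ₗ[A] ∀ I : Sub s p, shiftGrading ℳ (∑ i ∈ I.1, d i) ν where
  toFun x I := ⟨x.1 I, x.2 I (Set.mem_univ _)⟩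
  invFun y := ⟨fun I => y I, fun I _ => (y I).2⟩
  map_add' _ _ := rfl
  map_smul' _ _ := rfl

theorem free_koszulSlice (hfree : ∀ ν, Module.Free A (ℳ ν)) (d : Fin s → Fin q → ℕ)
    (ν : Fin q → ℕ) (p : ℕ) : Module.Free A (koszulSlice ℳ d ν p) := by
  have : ∀ I : Sub s p, Module.Free A (shiftGrading ℳ (∑ i ∈ I.1, d i) ν) := fun I => by
    by_cases h : ∑ i ∈ I.1, d i ≤ ν
    · rw [shiftGrading_of_le h]; exact hfree _
    · rw [shiftGrading_of_not_le h]; infer_instance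
  exact Module.Free.of_equiv (koszulSliceEquiv ℳ d ν p).symm

theorem finite_koszulSlice (hfin : ∀ ν, Module.Finite A (ℳ ν)) (d : Fin s → Fin q → ℕ)
    (ν : Fin q → ℕ) (p : ℕ) : Module.Finite A (koszulSlice ℳ d ν p) := by
  have : ∀ I : Sub s p, Module.Finite A (shiftGrading ℳ (∑ i ∈ I.1, d i) ν) := fun I => by
    by_cases h : ∑ i ∈ I.1, d i ≤ ν
    · rw [shiftGrading_of_le h]; exact hfin _
    · rw [shiftGrading_of_not_le h]; infer_instance
  exact Module.Finite.equiv (koszulSliceEquiv ℳ d ν p).symm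

theorem subsingleton_koszulSlice (d : Fin s → Fin q → ℕ) (ν : Fin q → ℕ) :
    Subsingleton (koszulSlice ℳ d ν (s + 1)) := by
  have : IsEmpty (Sub s (s + 1)) := ⟨fun I => by
    have := Finset.card_le_univ I.1
    rw [I.2, Fintype.card_fin] at this
    omega⟩
  exact (koszulSliceEquiv ℳ d ν (s + 1)).injective.subsingleton

end SliceComponents

/-! ### Slices as resolutions of the components of `M / (f) M`. -/

section Slices

variable {A : Type*} [CommRing A] {q : ℕ} {R : Type*} [CommRing R] [Algebra A R]
  {M : Type*} [AddCommGroup M] [Module A M] [Module R M] [IsScalarTower A R M] {s : ℕ}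
  {𝒜 : (Fin q → ℕ) → Submodule A R} {ℳ : (Fin q → ℕ) → Submodule A M}

/-- The map `K_0^ν(f, M) = M_ν → (M / (f) M)_ν`. -/
def augmentation (ℳ : (Fin q → ℕ) → Submodule A M) (f : Fin s → R) (d : Fin s → Fin q → ℕ)
    (ν : Fin q → ℕ) : koszulSlice ℳ d ν 0 →ₗ[A] koszulQuot ℳ f ν :=
  LinearMap.codRestrict _
    ((Submodule.mkQ (Ideal.span (Set.range f) • (⊤ : Submodule R M))).restrictScalars A ∘ₗ
      LinearMap.proj (Sub.empty s) ∘ₗ (koszulSlice ℳ d ν 0).subtype)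
    fun x => ⟨x.1 (Sub.empty s), koszulSlice_zero_apply_mem x, rfl⟩

theorem augmentation_surjective (f : Fin s → R) (d : Fin s → Fin q → ℕ) (ν : Fin q → ℕ) :
    Function.Surjective (augmentation ℳ f d ν) := by
  rintro ⟨_, x, hx, rfl⟩
  refine ⟨⟨fun _ => x, mem_koszulSlice.2 fun J => ?_⟩, rfl⟩
  rw [J.eq_empty, Sub.empty, Finset.sum_empty, shiftGrading_zero]
  exact hx

variable [SetLike.GradedSMul 𝒜 ℳ] [DirectSum.Decomposition ℳ]

/-- The slices of the Koszul complex of a filter-regular sequence are acyclic in large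
multidegrees. -/
theorem eventually_exact_koszulSliceD {f : Fin s → R} {d : Fin s → Fin q → ℕ}
    (hf : ∀ i, f i ∈ 𝒜 (d i)) (hreg : IsFilterRegularSeq ℳ f) :
    ∀ᶠ ν in Filter.atTop, ∀ p, Function.Exact (koszulSliceD 𝒜 ℳ hf ν (p + 1))
      (koszulSliceD 𝒜 ℳ hf ν p) := by
  filter_upwards [eventually_exists_totalD_eq hf hreg s le_rfl] with ν hν p x
  constructor
  · intro hx
    -- A cycle of degree `p + 1` is extended by zero to all subsets. Its coordinate at `∅` is then
    -- zero, and a primitive restricts to the subsets with `p + 2` elements.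
    let m : Finset (Fin s) → M := fun J => if h : J.card = p + 1 then x.1 ⟨J, h⟩ else 0
    have hmx : (fun I : Sub s (p + 1) => m I.1) = x.1 := funext fun I => dif_pos I.2
    obtain ⟨w, hw, -, -, hwD⟩ := hν m
      (mem_totalSlice.2 fun J => by
        by_cases h : J.card = p + 1
        · simp only [m, dif_pos h]
          exact mem_koszulSlice.1 x.2 ⟨J, h⟩
        · simp only [m, dif_neg h]
          exact Submodule.zero_mem _)
      (fun J j _ hj => absurd j.2 (by omega))
      (dif_neg (by simp))
      (by
        funext J
        by_cases h : J.card = p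
        · rw [totalD_eq_koszulD f m (⟨J, h⟩ : Sub s p), hmx]
          exact congrFun (congrArg Subtype.val hx) ⟨J, h⟩
        · rw [totalD_apply]
          refine Finset.sum_eq_zero fun i _ => ?_
          split_ifs with hi
          · rfl
          · simp only [m]
            rw [dif_neg, smul_zero]
            rw [Finset.card_insert_of_notMem hi]
            omega)
    refine ⟨⟨fun I => w I.1, restrict_mem_koszulSlice hw _⟩, Subtype.ext (funext fun J => ?_)⟩
    change koszulD f M (p + 1) (fun I => w I.1) J = x.1 J
    rw [← totalD_eq_koszulD, hwD, ← hmx]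
  · rintro ⟨y, rfl⟩
    exact Subtype.ext (LinearMap.congr_fun (koszulD_comp (M := M) f p) y.1)

theorem partialSubmodule_eq (f : Fin s → R) :
    partialSubmodule f M s = Ideal.span (Set.range f) • (⊤ : Submodule R M) := by
  have : {j : Fin s | (j : ℕ) < s} = Set.univ := Set.eq_univ_of_forall fun j => j.2
  rw [partialSubmodule, this, Set.image_univ]

theorem exact_augmentation {f : Fin s → R} {d : Fin s → Fin q → ℕ}
    (hf : ∀ i, f i ∈ 𝒜 (d i)) (ν : Fin q → ℕ) :
    Function.Exact (koszulSliceD 𝒜 ℳ hf ν 0) (augmentation ℳ f d ν) := by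
  intro x
  have hiff : augmentation ℳ f d ν x = 0 ↔ x.1 (Sub.empty s) ∈ partialSubmodule f M s := by
    rw [partialSubmodule_eq, ← Submodule.Quotient.mk_eq_zero]
    exact Subtype.ext_iff
  rw [hiff]
  constructor
  · intro hx
    obtain ⟨y, hy, -, hyx⟩ := exists_homogeneous_of_mem_partialSubmodule hf
      (koszulSlice_zero_apply_mem x) hx
    refine ⟨⟨fun I => ofSingletons y I.1,
      restrict_mem_koszulSlice (ofSingletons_mem_totalSlice hy) _⟩,
      Subtype.ext (funext fun J => ?_)⟩
    change koszulD f M 0 (fun I => ofSingletons y I.1) J = x.1 J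
    rw [← totalD_eq_koszulD, totalD_ofSingletons, J.eq_empty, ← hyx, Sub.empty, if_pos rfl]
  · rintro ⟨y, rfl⟩
    change ∑ i : {i : Fin s // i ∉ (∅ : Finset (Fin s))},
      (koszulSign R ∅ i.1 * f i.1) • y.1 ((Sub.empty s).insert i) ∈ _
    refine Submodule.sum_mem _ fun i _ => ?_
    rw [mul_smul]
    exact Submodule.smul_mem _ _ (smul_mem_partialSubmodule f i.1.2 _)

end Slices

/-! ### Differences of polynomials and total degree. -/

section Difference

variable {σ : Type*} (d : σ → ℚ)

/-- The polynomial `P(t - d)`. -/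
noncomputable def translate (P : MvPolynomial σ ℚ) : MvPolynomial σ ℚ :=
  MvPolynomial.bind₁ (fun p => MvPolynomial.X p - MvPolynomial.C (d p)) P

theorem eval_translate (x : σ → ℚ) (P : MvPolynomial σ ℚ) :
    MvPolynomial.eval x (translate d P) = MvPolynomial.eval (fun p => x p - d p) P := by
  induction P using MvPolynomial.induction_on with
  | C a => simp [translate]
  | add P Q hP hQ => simpa [translate] using congrArg₂ (· + ·) hP hQ
  | mul_X P i hP => simpa [translate] using Or.inl hP

/-- A Leibniz rule for the difference operator, which drives the induction on the degree of a
monomial. -/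
theorem sub_translate_X_mul (i : σ) (P : MvPolynomial σ ℚ) :
    MvPolynomial.X i * P - translate d (MvPolynomial.X i * P) =
      (MvPolynomial.X i - MvPolynomial.C (d i)) * (P - translate d P) +
        MvPolynomial.C (d i) * P := by
  simp only [translate, map_mul, MvPolynomial.bind₁_X_right]
  ring

theorem sub_translate_C (a : ℚ) :
    (MvPolynomial.C a : MvPolynomial σ ℚ) - translate d (MvPolynomial.C a) = 0 := by
  simp [translate]

theorem totalDegree_sub_translate_monomial (m : σ →₀ ℕ) (a : ℚ) :
    (MvPolynomial.monomial m a - translate d (MvPolynomial.monomial m a)).totalDegree ≤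
      m.degree - 1 := by
  induction h : m.degree generalizing m with
  | zero =>
    rw [Finsupp.degree_eq_zero_iff] at h
    rw [h, ← MvPolynomial.C_apply, sub_translate_C]
    simp
  | succ k ih =>
    have hm : m ≠ 0 := fun h0 => by simp [h0] at h
    obtain ⟨i, hi⟩ := Finsupp.ne_iff.1 hm
    obtain ⟨m', rfl⟩ : ∃ m', m = Finsupp.single i 1 + m' :=
      ⟨m - Finsupp.single i 1, (add_tsub_cancel_of_le (by
        rw [Finsupp.single_le_iff]; exact Nat.one_le_iff_ne_zero.2 hi)).symm⟩
    have hk : m'.degree = k := by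
      rw [map_add, Finsupp.degree_single] at h
      omega
    have hX : (MvPolynomial.monomial (Finsupp.single i 1 + m') a : MvPolynomial σ ℚ) =
        MvPolynomial.X i * MvPolynomial.monomial m' a := by
      rw [MvPolynomial.X, MvPolynomial.monomial_mul, one_mul]
    rw [hX, sub_translate_X_mul, add_tsub_cancel_right]
    refine (MvPolynomial.totalDegree_add _ _).trans (max_le ?_ ?_)
    -- The bound `k - 1` is truncated at `k = 0`, so there the difference must be seen to vanish
    -- exactly.
    · rcases Nat.eq_zero_or_pos k with h0 | h0
      · rw [h0, Finsupp.degree_eq_zero_iff] at hk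
        rw [hk, ← MvPolynomial.C_apply, sub_translate_C, mul_zero]
        simp
      · have h1 := ih m' hk
        refine (MvPolynomial.totalDegree_mul _ _).trans ?_
        have h2 : (MvPolynomial.X i - MvPolynomial.C (d i) : MvPolynomial σ ℚ).totalDegree ≤ 1 :=
          (MvPolynomial.totalDegree_sub_C_le _ _).trans (MvPolynomial.totalDegree_X i).le
        omega
    · refine (MvPolynomial.totalDegree_mul _ _).trans ?_
      rw [MvPolynomial.totalDegree_C, zero_add, ← hk]
      exact MvPolynomial.totalDegree_monomial_le _ _

/-- Taking a difference lowers the total degree, or gives zero. -/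
theorem sub_translate_eq_zero_or (P : MvPolynomial σ ℚ) :
    P - translate d P = 0 ∨ (P - translate d P).totalDegree + 1 ≤ P.totalDegree := by
  rcases Nat.eq_zero_or_pos P.totalDegree with h | h
  · left
    rw [MvPolynomial.totalDegree_eq_zero_iff_eq_C] at h
    rw [h, sub_translate_C]
  · right
    suffices (P - translate d P).totalDegree ≤ P.totalDegree - 1 by omega
    have hP : P - translate d P = ∑ m ∈ P.support,
        (MvPolynomial.monomial m (P.coeff m) -
          translate d (MvPolynomial.monomial m (P.coeff m))) := by
      rw [Finset.sum_sub_distrib]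
      simp only [translate]
      rw [← map_sum, ← P.as_sum]
    rw [hP]
    refine MvPolynomial.totalDegree_finsetSum_le fun m hm => ?_
    exact (totalDegree_sub_translate_monomial d m _).trans
      (Nat.sub_le_sub_right (MvPolynomial.le_totalDegree hm) 1)

end Difference

/-! ### Ranks of the successive quotients. -/

section Rank

variable {A : Type*} [CommRing A] [IsDomain A] {q : ℕ} {R : Type*} [CommRing R] [Algebra A R]
  {M : Type*} [AddCommGroup M] [Module A M] [Module R M] [IsScalarTower A R M] {s : ℕ}
  {𝒜 : (Fin q → ℕ) → Submodule A R}
  {ℳ : (Fin q → ℕ) → Submodule A M} [SetLike.GradedSMul 𝒜 ℳ] [DirectSum.Decomposition ℳ]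

theorem partialSubmodule_mono (f : Fin s → R) {t t' : ℕ} (h : t ≤ t') :
    partialSubmodule f M t ≤ partialSubmodule f M t' :=
  Submodule.smul_mono_left (Ideal.span_mono (Set.image_mono fun _ hj => lt_of_lt_of_le hj h))

/-- Additivity of rank in the short exact sequence in which multiplication by `f τ` maps the
component `ν - d τ` of `M / (f_0, …, f_{τ-1}) M` into the component `ν`, with cokernel the component
`ν` of the next quotient. -/
theorem finrank_quotGrading_succ {f : Fin s → R} {d : Fin s → Fin q → ℕ}
    (hf : ∀ i, f i ∈ 𝒜 (d i)) (hfin : ∀ ν, Module.Finite A (ℳ ν)) {ν : Fin q → ℕ} (τ : Fin s)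
    (hτ : d τ ≤ ν) (hreg : ∀ x ∈ ℳ (ν - d τ), f τ • x ∈ partialSubmodule f M τ →
      x ∈ partialSubmodule f M τ) :
    Module.finrank A (quotGrading ℳ (partialSubmodule f M τ) ν) =
      Module.finrank A (quotGrading ℳ (partialSubmodule f M τ) (ν - d τ)) +
        Module.finrank A (quotGrading ℳ (partialSubmodule f M (τ + 1)) ν) := by
  let N := partialSubmodule f M τ
  let N' := partialSubmodule f M (τ + 1)
  have hN : N ≤ N' := partialSubmodule_mono f (Nat.le_succ _)
  let F : (M ⧸ N) →ₗ[A] (M ⧸ N) := (LinearMap.lsmul R (M ⧸ N) (f τ)).restrictScalars A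
  let G : (M ⧸ N) →ₗ[A] (M ⧸ N') := (Submodule.factor hN).restrictScalars A
  have : Module.Finite A (quotGrading ℳ N ν) := Module.Finite.map _ _
  have hrange : LinearMap.range (G.domRestrict (quotGrading ℳ N ν)) = quotGrading ℳ N' ν := by
    rw [LinearMap.range_domRestrict, quotGrading, ← Submodule.map_comp]
    rfl
  -- Exactness in the middle: an element of `M_ν` in `(f_0, …, f_τ) M` has homogeneous coefficients,
  -- and modulo `N` only the term with `f τ` survives.
  have hF : LinearMap.range (F.domRestrict (quotGrading ℳ N (ν - d τ))) =
      (LinearMap.ker (G.domRestrict (quotGrading ℳ N ν))).map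
        (quotGrading ℳ N ν).subtype := by
    rw [LinearMap.range_domRestrict, LinearMap.ker_domRestrict, Submodule.map_comap_subtype]
    ext z
    constructor
    · rintro ⟨_, ⟨x, hx, rfl⟩, rfl⟩
      refine ⟨⟨f τ • x, ?_, rfl⟩, ?_⟩
      · have := smul_mem_shiftGrading (ℳ := ℳ) (hf τ) (d := 0) (ν := ν) (m := x)
          (by rwa [add_zero, shiftGrading_of_le hτ])
        rwa [shiftGrading_zero] at this
      · change Submodule.Quotient.mk (p := N') (f τ • x) = 0
        rw [Submodule.Quotient.mk_eq_zero]
        exact smul_mem_partialSubmodule f (Nat.lt_succ_self _) x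
    · rintro ⟨⟨x, hx, rfl⟩, hz⟩
      have hx' : x ∈ N' := by
        rw [← Submodule.Quotient.mk_eq_zero]; exact hz
      obtain ⟨y, hy, hyt, rfl⟩ := exists_homogeneous_of_mem_partialSubmodule hf hx hx'
      have hyτ := hy τ
      rw [shiftGrading_of_le hτ] at hyτ
      refine ⟨Submodule.Quotient.mk (y τ), ⟨y τ, hyτ, rfl⟩, ?_⟩
      change Submodule.Quotient.mk (p := N) (f τ • y τ) = Submodule.Quotient.mk (∑ j, f j • y j)
      rw [Submodule.Quotient.eq, ← Finset.add_sum_erase _ _ (Finset.mem_univ τ),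
        sub_add_cancel_left]
      refine Submodule.neg_mem _ (Submodule.sum_mem _ fun j hj => ?_)
      rcases lt_or_ge (j : ℕ) τ with h | h
      · exact smul_mem_partialSubmodule f h _
      · have hne : j ≠ τ := (Finset.mem_erase.1 hj).1
        rw [hyt j (Nat.succ_le_of_lt (lt_of_le_of_ne h fun h' => hne (Fin.ext h'.symm))),
          smul_zero]
        exact Submodule.zero_mem _
  have hinj : Function.Injective (F.domRestrict (quotGrading ℳ N (ν - d τ))) := by
    rw [← LinearMap.ker_eq_bot, LinearMap.ker_eq_bot']
    rintro ⟨_, x, hx, rfl⟩ h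
    have h' : Submodule.Quotient.mk (p := N) (f τ • x) = 0 := h
    rw [Submodule.Quotient.mk_eq_zero] at h'
    exact Subtype.ext ((Submodule.Quotient.mk_eq_zero N).2 (hreg x hx h'))
  have h1 := Submodule.finrank_quotient_add_finrank
    (LinearMap.ker (G.domRestrict (quotGrading ℳ N ν)))
  rw [(LinearMap.quotKerEquivRange _).finrank_eq] at h1
  have h2 := LinearMap.finrank_range_of_inj hinj
  rw [hF, ← (Submodule.equivMapOfInjective _ (Submodule.subtype_injective _) _).finrank_eq] at h2
  rw [hrange, h2, add_comm] at h1
  exact h1.symm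

/-- The rank of the components of `M / (f_0, …, f_{t-1}) M` is eventually polynomial, of a degree
that drops with `t`. -/
theorem exists_poly_finrank_quotGrading {f : Fin s → R} {d : Fin s → Fin q → ℕ}
    (hf : ∀ i, f i ∈ 𝒜 (d i)) (hreg : IsFilterRegularSeq ℳ f)
    (hfree : ∀ ν, Module.Free A (ℳ ν)) (hfin : ∀ ν, Module.Finite A (ℳ ν))
    {P : MvPolynomial (Fin q) ℚ} (hP : IsHilbertPoly ℳ P) (hs : P = 0 ∨ P.totalDegree + 1 ≤ s)
    (t : ℕ) (ht : t ≤ s) :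
    ∃ Q : MvPolynomial (Fin q) ℚ, (Q = 0 ∨ Q.totalDegree + 1 + t ≤ s) ∧
      ∀ᶠ ν : Fin q → ℕ in Filter.atTop,
        (Module.finrank A (quotGrading ℳ (partialSubmodule f M t) ν) : ℚ) =
          MvPolynomial.eval (fun p => (ν p : ℚ)) Q := by
  induction t with
  | zero =>
    refine ⟨P, hs, ?_⟩
    filter_upwards [hP] with ν hν
    rw [← hν]
    have := hfree ν
    have h0 : partialSubmodule f M 0 = ⊥ := by simp [partialSubmodule]
    have hinj : Function.Injective
        ((partialSubmodule f M 0).mkQ.restrictScalars A : M →ₗ[A] _) := by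
      rw [← LinearMap.ker_eq_bot, LinearMap.ker_restrictScalars, Submodule.ker_mkQ, h0]
      rfl
    rw [Module.finrank_baseChange, quotGrading,
      (Submodule.equivMapOfInjective _ hinj (ℳ ν)).finrank_eq]
  | succ t ih =>
    obtain ⟨Q, hQ, hQν⟩ := ih (by omega)
    let τ : Fin s := ⟨t, ht⟩
    refine ⟨Q - translate (fun p => (d τ p : ℚ)) Q, ?_, ?_⟩
    · rcases hQ with rfl | hQ
      · left; simp [translate]
      · rcases sub_translate_eq_zero_or (fun p => (d τ p : ℚ)) Q with h | h
        · exact Or.inl h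
        · right; omega
    · filter_upwards [hQν, eventually_tsub hQν (d τ),
        eventually_tsub (hreg.eventually_mem τ) (d τ)] with ν h1 ⟨hd, h2⟩ ⟨_, h3⟩
      have h4 := finrank_quotGrading_succ hf hfin τ hd h3
      rw [map_sub, eval_translate, ← h1]
      have h5 : (fun p => ((ν - d τ) p : ℕ) : Fin q → ℚ) = fun p => (ν p : ℚ) - (d τ p : ℚ) :=
        funext fun p => by rw [Pi.sub_apply, Nat.cast_sub (hd p)]
      rw [← h5, ← h2, eq_sub_iff_add_eq, add_comm]
      exact_mod_cast h4.symm

end Rank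

/-- Rank zero means torsion, and a finitely generated torsion module has a single nonzero
annihilator. -/
theorem exists_smul_eq_zero_of_finrank_eq_zero {A : Type*} [CommRing A] [IsDomain A] {N : Type*}
    [AddCommGroup N] [Module A N] [Module.Finite A N] (h : Module.finrank A N = 0) :
    ∃ a : A, a ≠ 0 ∧ ∀ x : N, a • x = 0 := by
  rw [Module.finrank_eq_zero_iff_isTorsion] at h
  obtain ⟨a, ha, ha0⟩ := Set.nonempty_def.1
    (Submodule.annihilator_top_inter_nonZeroDivisors h)
  exact ⟨a, nonZeroDivisors.ne_zero ha0, fun x => (Submodule.mem_annihilator.1 ha) x trivial⟩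

/-- In large multidegrees `M / (f) M` is killed by a nonzero constant. -/
theorem eventually_exists_smul_koszulQuot_eq_zero {A : Type*} [CommRing A] [IsDomain A] {q : ℕ}
    {R : Type*} [CommRing R] [Algebra A R] {M : Type*} [AddCommGroup M] [Module A M] [Module R M]
    [IsScalarTower A R M] {s : ℕ} {𝒜 : (Fin q → ℕ) → Submodule A R}
    {ℳ : (Fin q → ℕ) → Submodule A M} [SetLike.GradedSMul 𝒜 ℳ] [DirectSum.Decomposition ℳ]
    {f : Fin s → R} {d : Fin s → Fin q → ℕ} (hf : ∀ i, f i ∈ 𝒜 (d i))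
    (hreg : IsFilterRegularSeq ℳ f) (hfree : ∀ ν, Module.Free A (ℳ ν))
    (hfin : ∀ ν, Module.Finite A (ℳ ν)) {r : ℤ} (hr : HasRelevantDim ℳ r) (hs : (s : ℤ) = r + 1) :
    ∀ᶠ ν in Filter.atTop, ∃ a : A, a ≠ 0 ∧ ∀ x : koszulQuot ℳ f ν, a • x = 0 := by
  obtain ⟨P, hP, hrP⟩ := hr
  have hdeg : P = 0 ∨ P.totalDegree + 1 ≤ s := by
    by_cases h : P = 0
    · exact Or.inl h
    · rw [if_neg h] at hrP
      right
      omega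
  obtain ⟨Q, hQ, hQν⟩ := exists_poly_finrank_quotGrading hf hreg hfree hfin hP hdeg s le_rfl
  -- At `t = s` the degree bound would read `Q.totalDegree + 1 + s ≤ s`.
  have hQ0 : Q = 0 := hQ.resolve_right (by omega)
  filter_upwards [hQν] with ν hν
  rw [hQ0, map_zero, Nat.cast_eq_zero, partialSubmodule_eq] at hν
  have : Module.Finite A (koszulQuot ℳ f ν) := by
    have := hfin ν
    exact Module.Finite.map _ _
  exact exists_smul_eq_zero_of_finrank_eq_zero (N := koszulQuot ℳ f ν) hν

end MultiKoszul

theorem mainTheorem4 {A : Type*} [CommRing A] [IsDomain A] [IsNoetherianRing A]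
    [UniqueFactorizationMonoid A]
    {q : ℕ} (hq : 0 < q) (n : Fin q → ℕ) (hn : ∀ p, 0 < n p)
    {M : Type*} [AddCommGroup M] [Module A M] [Module (MultiKoszul.Poly A n) M]
    [IsScalarTower A (MultiKoszul.Poly A n) M]
    (ℳ : (Fin q → ℕ) → Submodule A M) [DirectSum.Decomposition ℳ]
    [SetLike.GradedSMul (MultiKoszul.polyGrading A n) ℳ]
    (hM : MultiKoszul.IsComponentwiseFree n ℳ)
    {s : ℕ} (f : Fin s → MultiKoszul.Poly A n) (d : Fin s → Fin q → ℕ)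
    (hf : ∀ i, f i ∈ MultiKoszul.polyGrading A n (d i))
    (hreg : MultiKoszul.IsFilterRegularSeq ℳ f)
    (r : ℤ) (hr : MultiKoszul.HasRelevantDim ℳ r) (hs : (s : ℤ) = r + 1)
    (P : MultiKoszul.IrrReps A) :
    ∀ᶠ ν : Fin q → ℕ in Filter.atTop,
      MultiKoszul.IsGenericallyExact (C := fun p => MultiKoszul.koszulSlice ℳ d ν p)
          (MultiKoszul.koszulSliceD (MultiKoszul.polyGrading A n) ℳ hf ν) ∧
        Module.annihilator A (MultiKoszul.koszulQuot ℳ f ν) ≠ ⊥ ∧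
        Nonempty (MultiKoszul.CayleyData (C := fun p => MultiKoszul.koszulSlice ℳ d ν p)
          (MultiKoszul.koszulSliceD (MultiKoszul.polyGrading A n) ℳ hf ν) s) ∧
        ∀ c : MultiKoszul.CayleyData (C := fun p => MultiKoszul.koszulSlice ℳ d ν p)
            (MultiKoszul.koszulSliceD (MultiKoszul.polyGrading A n) ℳ hf ν) s,
          ∃ u : Aˣ, c.det = algebraMap A (FractionRing A)
            (u * MultiKoszul.content P (MultiKoszul.koszulQuot ℳ f ν)) := by
  filter_upwards [MultiKoszul.eventually_exact_koszulSliceD hf hreg,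
    MultiKoszul.eventually_exists_smul_koszulQuot_eq_zero hf hreg hM.free_component
      hM.finite_component hr hs] with ν hexact ⟨a, ha, haN⟩
  have hfree := MultiKoszul.free_koszulSlice hM.free_component d ν
  have hfin := MultiKoszul.finite_koszulSlice hM.finite_component d ν
  have hsub := MultiKoszul.subsingleton_koszulSlice (ℳ := ℳ) d ν
  have hε := MultiKoszul.exact_augmentation (ℳ := ℳ) hf ν
  -- A constant killing the quotient sends every element of degree zero into the kernel of the
  -- augmentation, that is, into the boundaries.
  have h0 : ∀ x : MultiKoszul.koszulSlice ℳ d ν 0, ∃ a : A, a ≠ 0 ∧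
      a • x ∈ LinearMap.range (MultiKoszul.koszulSliceD (MultiKoszul.polyGrading A n) ℳ hf ν 0) :=
    fun x => ⟨a, ha, (hε _).1 (by rw [map_smul, haN])⟩
  refine ⟨MultiKoszul.isGenericallyExact_of_exact hexact h0, fun hann => ha ?_,
    MultiKoszul.CayleyData.nonempty hexact h0, fun c => ?_⟩
  · rw [← Submodule.mem_bot A, ← hann]
    exact Module.mem_annihilator.2 haN
  · exact c.det_eq_content hexact P (MultiKoszul.augmentation ℳ f d ν)
      (MultiKoszul.augmentation_surjective f d ν) hε
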